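/- Let $\cdots\to X_{n+1}\xrightarrow{p_{n+1}}X_n\to\cdots\xrightarrow{p_1}X_0$ be a tower of (Serre) fibrations of topological spaces. Choose a basepoint $x=(x_n)_{n\ge 0}\in\lim_n X_n$ and use $x_n$ as the basepoint of $X_n$. For a tower of groups $(G_n,q_n)$ let $\lim^1_n G_n$ be the set of orbits of the left action of the group $\prod_n G_n$ on the set $\prod_n G_n$ given by $(g_n)\cdot(h_n)=\bigl(g_n\,h_n\,q_{n+1}(g_{n+1}^{-1})\bigr)_{n\ge 0}$, pointed by the orbit of the identity; if all the $G_n$ are abelian, $\lim^1_nG_n$ is an abelian group, with product induced by that of $\prod_n G_n$. For every $k\ge 0$ there is a short exact sequence $$1\to {\lim_n}^1\,\pi_{k+1}X_n\xrightarrow{\ \iota\ }\pi_k(\lim_n X_n)\xrightarrow{\ P\ }\lim_n\pi_kX_n\to 1,$$ natural with respect to maps of towers, where $P$ is the canonical map; here exactness means that $P$ is surjective and that $\iota$ is injective with image the set of elements that $P$ sends to the distinguished point. It is a sequence of pointed sets for $k=0$, of groups for $k=1$, and of abelian groups for $k\ge 2$. Suppose in addition that every $X_n$ is an H-space whose unit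 is $x_n$ (unit up to homotopy relative to $x_n$) and that every $p_n$ is an H-map, in the sense that $p_n(ab)=p_n(a)p_n(b)$. Then $\lim_nX_n$ has a coordinatewise multiplication, which induces a multiplication on $\pi_0(\lim_nX_n)$, and $\lim_n\pi_0X_n$ has the coordinatewise one. The groups $\pi_1X_n$ are abelian, so that $\lim^1_n\pi_1X_n$ is an abelian group, and for $k=0$ both $\iota$ and $P$ are multiplicative. Hence the sequence for $k=0$ is a short exact sequence of groups as soon as the multiplication on $\pi_0(\lim_nX_n)$ is a group law with unit $[x]$ (the one on $\lim_n\pi_0X_n$ is then a group law too). This holds, and every $\pi_0X_n$ is a group as well, whenever every element of every $\pi_0 X_n$ has a two-sided inverse and the $X_n$ have associativity homotopies which, together with the unit homotopies of the $X_n$, are preserved by the maps $p_n$. -/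

import Mathlib

open scoped Topology unitInterval

universe u

noncomputable section

/-- A Serre fibration: a map with the homotopy lifting property for all cubes `I^n`, `n ≥ 0`. -/
def IsSerreFibration {E B : Type*} [TopologicalSpace E] [TopologicalSpace B] (p : C(E, B)) : Prop :=
  ∀ (n : ℕ) (f : C(Fin n → I, E)) (H : C(I × (Fin n → I), B)),
    (∀ a, H (0, a) = p (f a)) →
    ∃ K : C(I × (Fin n → I), E), (∀ a, K (0, a) = f a) ∧ ∀ y, p (K y) = H y

/-! ### Induced maps on homotopy groups -/

/-- The map of based cubes induced by a based map. -/
def genLoopMap {N X Y : Type*} [TopologicalSpace X] [TopologicalSpace Y] {x : X} {y : Y}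
    (f : C(X, Y)) (h : f x = y) (a : GenLoop N X x) : GenLoop N Y y :=
  ⟨f.comp a.1, fun t ht => by
    rw [ContinuousMap.comp_apply, a.2 t ht, h]⟩

/-- The map `f_* : π_k(X, x) → π_k(Y, y)` induced by a map `f` with `f x = y`. -/
def piMap {X Y : Type*} [TopologicalSpace X] [TopologicalSpace Y] {x : X} {y : Y}
    (k : ℕ) (f : C(X, Y)) (h : f x = y) : π_ k X x → π_ k Y y :=
  Quotient.map (genLoopMap f h) fun _ _ H => H.map fun F => F.compContinuousMap f

/-- For positive degrees `f_*` is a group homomorphism. -/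
def piHom {X Y : Type*} [TopologicalSpace X] [TopologicalSpace Y] {x : X} {y : Y}
    (k : ℕ) (f : C(X, Y)) (h : f x = y) : π_ (k + 1) X x →* π_ (k + 1) Y y where
  toFun := piMap (k + 1) f h
  map_one' := by
    rw [HomotopyGroup.one_def, HomotopyGroup.one_def]
    refine congrArg (Quotient.mk _) ?_
    ext t
    exact h
  map_mul' a b := by
    refine Quotient.inductionOn₂ a b fun a b => ?_
    have h1 := HomotopyGroup.mul_spec (i := (0 : Fin (k + 1))) (p := a) (q := b)
    have h2 := HomotopyGroup.mul_spec (i := (0 : Fin (k + 1)))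
      (p := genLoopMap f h a) (q := genLoopMap f h b)
    refine (congrArg (piMap (k + 1) f h) h1).trans (Eq.trans ?_ h2.symm)
    refine congrArg (Quotient.mk _) ?_
    ext t
    change f (GenLoop.transAt 0 b a t) = GenLoop.transAt 0 (genLoopMap f h b) (genLoopMap f h a) t
    simp only [GenLoop.transAt, GenLoop.coe_copy]
    split_ifs <;> rfl

/-- `π_k` is abelian for `k ≥ 2`. -/
theorem pi_mul_comm {X : Type*} [TopologicalSpace X] {x : X} (k : ℕ)
    (a b : π_ (k + 1 + 1) X x) :
    letI : Group (π_ (k + 1 + 1) X x) := HomotopyGroup.group (Fin (k + 1 + 1))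
    a * b = b * a :=
  mul_comm (G := HomotopyGroup (Fin (k + 1 + 1)) X x) a b

/-! ### `lim` and `lim¹` of a tower of groups -/

section TowerOfGroups

variable {G : ℕ → Type u} [∀ n, Group (G n)] (q : ∀ n, G (n + 1) →* G n)

/-- The inverse limit of a tower of groups. -/
def limSubgroup : Subgroup (∀ n, G n) where
  carrier := {a | ∀ n, q n (a (n + 1)) = a n}
  mul_mem' ha hb n := by simp [ha n, hb n]
  one_mem' n := by simp
  inv_mem' ha n := by simp [ha n]

/-- The action `(g • h)_n = g_n * h_n * p_{n+1}(g_{n+1}⁻¹)` of `∏ G_n` on the set `∏ G_n`. -/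
abbrev twistedAction : MulAction (∀ n, G n) (∀ n, G n) where
  smul g h := fun n => g n * h n * q n ((g (n + 1))⁻¹)
  one_smul h := by
    funext n
    change (1 : G n) * h n * q n ((1 : G (n + 1))⁻¹) = h n
    simp
  mul_smul g g' h := by
    funext n
    change (g n * g' n) * h n * q n ((g (n + 1) * g' (n + 1))⁻¹)
      = g n * (g' n * h n * q n ((g' (n + 1))⁻¹)) * q n ((g (n + 1))⁻¹)
    simp [mul_assoc]

/-- `lim¹` of a tower of groups: the set of orbits of the twisted action. -/
def LimOne : Type u :=
  Quotient (@MulAction.orbitRel (∀ n, G n) (∀ n, G n) _ (twistedAction q))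

namespace LimOne

variable {q}

/-- The class of an element of the product. -/
def mk (q : ∀ n, G (n + 1) →* G n) (h : ∀ n, G n) : LimOne q :=
  Quotient.mk (@MulAction.orbitRel (∀ n, G n) (∀ n, G n) _ (twistedAction q)) h

theorem mk_eq_iff (h h' : ∀ n, G n) :
    mk q h = mk q h' ↔ ∃ g : ∀ n, G n, ∀ n, g n * h' n * q n ((g (n + 1))⁻¹) = h n := by
  refine Quotient.eq.trans ?_
  refine (@MulAction.orbitRel_apply (∀ n, G n) (∀ n, G n) _ (twistedAction q) h h').trans ?_
  constructor
  · rintro ⟨g, hg⟩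
    exact ⟨g, fun n => congrFun hg n⟩
  · rintro ⟨g, hg⟩
    exact ⟨g, funext hg⟩

/-- `lim¹` of a tower of abelian groups is the abelian group whose product is induced by the
product of `∏ G_n`. -/
abbrev commGroup (hc : ∀ n, ∀ a b : G n, a * b = b * a) : CommGroup (LimOne q) where
  mul := Quotient.map₂ (fun a b => a * b) (by
    intro a a' ha b b' hb
    obtain ⟨g, hg⟩ := (mk_eq_iff (q := q) a a').1 (Quotient.sound ha)
    obtain ⟨g', hg'⟩ := (mk_eq_iff (q := q) b b').1 (Quotient.sound hb)
    refine Quotient.exact ((mk_eq_iff (q := q) _ _).2 ⟨g * g', fun n => ?_⟩)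
    let _ : CommGroup (G n) := { (inferInstance : Group (G n)) with mul_comm := hc n }
    simp only [Pi.mul_apply, ← hg n, ← hg' n, mul_inv_rev, map_mul]
    have e : ∀ u v w x y z : G n, u * v * (w * x) * (y * z) = u * w * z * (v * x * y) := by
      intro u v w x y z
      have h := hc n
      simp only [mul_assoc]
      congr 1
      rw [← mul_assoc v w, h v w, mul_assoc]
      congr 1
      rw [← mul_assoc x y z, ← mul_assoc v (x * y) z, h _ z]
    exact e _ _ _ _ _ _)
  one := mk q 1
  inv := Quotient.map (fun a => a⁻¹) (by
    intro a a' ha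
    obtain ⟨g, hg⟩ := (mk_eq_iff (q := q) a a').1 (Quotient.sound ha)
    refine Quotient.exact ((mk_eq_iff (q := q) _ _).2 ⟨g⁻¹, fun n => ?_⟩)
    simp only [Pi.inv_apply, ← hg n, mul_inv_rev, map_inv, inv_inv]
    rw [hc n (g n)⁻¹, hc n _ (q n (g (n + 1))), ← mul_assoc])
  mul_assoc a b c := by
    refine Quotient.inductionOn₃ a b c fun a b c => congrArg (mk q) (mul_assoc a b c)
  one_mul a := Quotient.inductionOn a fun a => congrArg (mk q) (one_mul a)
  mul_one a := Quotient.inductionOn a fun a => congrArg (mk q) (mul_one a)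
  inv_mul_cancel a := Quotient.inductionOn a fun a => congrArg (mk q) (inv_mul_cancel a)
  mul_comm a b := Quotient.inductionOn₂ a b fun a b =>
    congrArg (mk q) (funext fun n => hc n (a n) (b n))

/-- The map of `lim¹` induced by a map of towers of groups. -/
def map {G' : ℕ → Type u} [∀ n, Group (G' n)] {q' : ∀ n, G' (n + 1) →* G' n}
    (φ : ∀ n, G n →* G' n) (hφ : ∀ n a, φ n (q n a) = q' n (φ (n + 1) a)) :
    LimOne q → LimOne q' :=
  Quotient.map (fun h n => φ n (h n)) (by
    intro a a' ha
    obtain ⟨g, hg⟩ := (mk_eq_iff (q := q) a a').1 (Quotient.sound ha)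
    refine Quotient.exact ((mk_eq_iff (q := q') _ _).2 ⟨fun n => φ n (g n), fun n => ?_⟩)
    simp only [← hg n, map_mul, hφ, map_inv])

end LimOne

end TowerOfGroups

/-! ### Towers of fibrations -/

/-- A tower `⋯ → X_{n+1} → X_n → ⋯ → X_0` of fibrations; `p n : X_{n+1} → X_n`. -/
structure FibrationTower where
  X : ℕ → Type u
  top : ∀ n, TopologicalSpace (X n)
  p : ∀ n, C(X (n + 1), X n)
  fib : ∀ n, IsSerreFibration (p n)

attribute [instance] FibrationTower.top

namespace FibrationTower

/-- The inverse limit, as a subspace of the product. -/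
abbrev Lim (T : FibrationTower.{u}) : Type u :=
  {x : ∀ n, T.X n // ∀ n, T.p n (x (n + 1)) = x n}

/-- The projection `lim X → X_n`. -/
def proj (T : FibrationTower.{u}) (n : ℕ) : C(T.Lim, T.X n) :=
  ⟨fun x => x.1 n, (continuous_apply n).comp continuous_subtype_val⟩

variable (T : FibrationTower.{u}) (x : T.Lim)

/-- The group `π_{k+1}(X_n, x_n)`. -/
abbrev PiGroup (k n : ℕ) : Type u := π_ (k + 1) (T.X n) (x.1 n)

/-- The homomorphisms `π_{k+1} X_{n+1} → π_{k+1} X_n` of the tower of homotopy groups, where each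
`X_n` has the basepoint `x_n`. -/
def piTower (k n : ℕ) :
    T.PiGroup x k (n + 1) →* T.PiGroup x k n :=
  piHom k (T.p n) (x.2 n)

/-- `lim¹_n π_{k+1} X_n`. -/
abbrev LimOnePi (k : ℕ) : Type u := LimOne (G := T.PiGroup x k) (T.piTower x k)

/-- The distinguished point of `lim¹_n π_{k+1} X_n`. -/
def limOneBase (k : ℕ) : T.LimOnePi x k := LimOne.mk (G := T.PiGroup x k) (T.piTower x k) 1

/-- `lim_n π_k X_n`, as a set. -/
def LimPi (k : ℕ) : Type u :=
  {a : ∀ n, π_ k (T.X n) (x.1 n) // ∀ n, piMap k (T.p n) (x.2 n) (a (n + 1)) = a n}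

/-- `lim_n π_k X_n` is a group for `k ≥ 1`. -/
instance limPiGroup (k : ℕ) : Group (T.LimPi x (k + 1)) :=
  inferInstanceAs (Group (limSubgroup (G := T.PiGroup x k) (T.piTower x k)))

/-- The distinguished point of `π_k (X, x)`, the class of the constant map. -/
def piBase {X : Type u} [TopologicalSpace X] (x : X) (k : ℕ) : π_ k X x :=
  Quotient.mk _ GenLoop.const

/-- The distinguished point of `lim_n π_k X_n`. -/
def limPiBase (k : ℕ) : T.LimPi x k :=
  ⟨fun n => piBase (x.1 n) k, fun n => congrArg (Quotient.mk _) (by ext t; exact x.2 n)⟩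

/-- The canonical map `P : π_k (lim X_n) → lim π_k X_n`. -/
def toLimPi (k : ℕ) (a : π_ k T.Lim x) : T.LimPi x k :=
  ⟨fun n => piMap k (T.proj n) rfl a, fun n => by
    refine Quotient.inductionOn a fun a => congrArg (Quotient.mk _) ?_
    ext t
    exact (a t).2 n⟩

variable {T}

/-- Maps of towers. -/
structure Hom (T T' : FibrationTower.{u}) where
  f : ∀ n, C(T.X n, T'.X n)
  comm : ∀ n a, f n (T.p n a) = T'.p n (f (n + 1) a)

namespace Hom

variable {x} {T' : FibrationTower.{u}} (F : Hom T T')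

/-- The induced map of limits. -/
def lim : C(T.Lim, T'.Lim) :=
  ⟨fun x => ⟨fun n => F.f n (x.1 n), fun n => by rw [← F.comm, x.2]⟩,
    Continuous.subtype_mk (continuous_pi fun n =>
      (F.f n).continuous.comp ((continuous_apply n).comp continuous_subtype_val)) _⟩

/-- The induced map `lim¹ π_{k+1} X_n → lim¹ π_{k+1} X'_n`. -/
def limOnePi (k : ℕ) : T.LimOnePi x k → T'.LimOnePi (F.lim x) k :=
  LimOne.map (G := T.PiGroup x k) (G' := T'.PiGroup (F.lim x) k)
    (q := T.piTower x k) (q' := T'.piTower (F.lim x) k) (fun n => piHom k (F.f n) rfl) fun n a => by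
    refine Quotient.inductionOn a fun a => congrArg (Quotient.mk _) ?_
    ext t
    exact F.comm n (a t)

/-- The induced map `lim π_k X_n → lim π_k X'_n`. -/
def limPi (k : ℕ) (a : T.LimPi x k) : T'.LimPi (F.lim x) k :=
  ⟨fun n => piMap k (F.f n) rfl (a.1 n), fun n => by
    refine Eq.trans ?_ (congrArg (piMap k (F.f n) rfl) (a.2 n))
    suffices h : ∀ c, piMap k (T'.p n) ((F.lim x).2 n) (piMap k (F.f (n + 1)) rfl c) =
        piMap k (F.f n) rfl (piMap k (T.p n) (x.2 n) c) from h (a.1 (n + 1))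
    intro c
    refine Quotient.inductionOn c fun c => congrArg (Quotient.mk _) ?_
    ext t
    exact (F.comm n (c t)).symm⟩

end Hom

end FibrationTower

/-! ### Short exact sequences -/

/-- `1 → A → B → C → 1` is a short exact sequence of pointed sets in the strong sense: the first
map identifies `A` with the fibre of the second map over the basepoint, and the second map is
onto. -/
structure IsShortExactPointed {A B C : Type*} (a₀ : A) (b₀ : B) (c₀ : C)
    (i : A → B) (P : B → C) : Prop where
  map_base_left : i a₀ = b₀
  map_base_right : P b₀ = c₀
  injective : Function.Injective i
  exact : ∀ b, P b = c₀ ↔ b ∈ Set.range i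
  surjective : Function.Surjective P

/-- `1 → A → B → C → 1` is a short exact sequence of groups. -/
structure IsShortExactGroup {A B C : Type*} [Group A] [Group B] [Group C]
    (i : A → B) (P : B → C) : Prop where
  map_mul_left : ∀ a a', i (a * a') = i a * i a'
  map_mul_right : ∀ b b', P (b * b') = P b * P b'
  injective : Function.Injective i
  exact : ∀ b, P b = 1 ↔ b ∈ Set.range i
  surjective : Function.Surjective P

/-- The multiplication `m` is a group law with unit `e`. -/
structure IsGroupLaw {A : Type*} (m : A → A → A) (e : A) : Prop where
  assoc : ∀ a b c, m (m a b) c = m a (m b c)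
  one_mul : ∀ a, m e a = a
  mul_one : ∀ a, m a e = a
  inv : ∀ a, ∃ b, m a b = e ∧ m b a = e

/-! ### H-spaces -/

/-- The multiplication on `π_0` induced by a continuous multiplication on the space. -/
def piZeroMul {X : Type u} [TopologicalSpace X] {x : X} (m : C(X × X, X)) :
    π_ 0 X x → π_ 0 X x → π_ 0 X x :=
  Quotient.map₂ (fun a b => ⟨m.comp (a.1.prodMk b.1), fun _ ⟨i, _⟩ => i.elim0⟩) (by
    rintro a a' ⟨H⟩ b b' ⟨K⟩
    exact ⟨⟨⟨m.comp (H.toContinuousMap.prodMk K.toContinuousMap), fun t => by simp,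
      fun t => by simp⟩, fun _ _ ⟨i, _⟩ => i.elim0⟩⟩)

namespace FibrationTower

/-- The spaces of the tower are H-spaces whose units are the basepoints, and the maps of the tower
preserve the multiplications. -/
structure HStructure (T : FibrationTower.{u}) (x : T.Lim) where
  H : ∀ n, HSpace (T.X n)
  unit : ∀ n, (H n).e = x.1 n
  map_hmul : ∀ n a b, T.p n ((H (n + 1)).hmul (a, b)) = (H n).hmul (T.p n a, T.p n b)

namespace HStructure

variable {T : FibrationTower.{u}} {x : T.Lim} (S : T.HStructure x)

/-- The coordinatewise multiplication on the limit. -/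
def limMul : C(T.Lim × T.Lim, T.Lim) :=
  ⟨fun y => ⟨fun n => (S.H n).hmul (y.1.1 n, y.2.1 n), fun n => by
    rw [S.map_hmul, y.1.2 n, y.2.2 n]⟩,
    Continuous.subtype_mk (continuous_pi fun n => (S.H n).hmul.continuous.comp
      (((T.proj n).continuous.comp continuous_fst).prodMk
        ((T.proj n).continuous.comp continuous_snd))) _⟩

/-- The coordinatewise multiplication on `lim π_0 X_n`. -/
def limPiZeroMul (a b : T.LimPi x 0) : T.LimPi x 0 :=
  ⟨fun n => piZeroMul (S.H n).hmul (a.1 n) (b.1 n), fun n => by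
    refine Eq.trans ?_ (congrArg₂ (piZeroMul (S.H n).hmul) (a.2 n) (b.2 n))
    suffices h : ∀ c d, piMap 0 (T.p n) (x.2 n) (piZeroMul (S.H (n + 1)).hmul c d) =
        piZeroMul (S.H n).hmul (piMap 0 (T.p n) (x.2 n) c) (piMap 0 (T.p n) (x.2 n) d) from
      h (a.1 (n + 1)) (b.1 (n + 1))
    intro c d
    refine Quotient.inductionOn₂ c d fun c d => congrArg (Quotient.mk _) ?_
    ext t
    exact S.map_hmul n (c t) (d t)⟩

/-- The H-spaces of the tower are homotopy associative and group-like (every element has a two-sided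
inverse up to paths), and there are associativity homotopies which, together with the unit
homotopies, are preserved by the maps of the tower. -/
structure IsGroupLike : Prop where
  assoc : ∃ A : ∀ n, C(I × (T.X n × T.X n × T.X n), T.X n),
    (∀ n a b c, A n (0, a, b, c) = (S.H n).hmul ((S.H n).hmul (a, b), c)) ∧
    (∀ n a b c, A n (1, a, b, c) = (S.H n).hmul (a, (S.H n).hmul (b, c))) ∧
    (∀ n t a b c, T.p n (A (n + 1) (t, a, b, c)) = A n (t, T.p n a, T.p n b, T.p n c))
  map_eHmul : ∀ n t a, T.p n ((S.H (n + 1)).eHmul (t, a)) = (S.H n).eHmul (t, T.p n a)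
  map_hmulE : ∀ n t a, T.p n ((S.H (n + 1)).hmulE (t, a)) = (S.H n).hmulE (t, T.p n a)
  inv : ∀ n a, ∃ b, Joined ((S.H n).hmul (a, b)) (x.1 n) ∧ Joined ((S.H n).hmul (b, a)) (x.1 n)

end HStructure

end FibrationTower

end

/-!
The degree `k` part of the sequence for a tower `X` is the degree `0` part for the tower of spaces
of based `k`-cubes `GenLoop (Fin k) (X n)`: path components of the latter are elements of `π_k`,
loops in it are `(k + 1)`-cubes (`loopClass`), and its maps are again Serre fibrations
(`IsSerreFibration.loopMap`). So the sequence is established for paths and path classes in an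
arbitrary tower, and then transported.

In degree zero, a point `b` of the limit which lies over the base components is joined to the
basepoint by path classes `γ n` in every `X n`. The image of `γ (n + 1)` in `X n` and `γ n` differ
by a loop class `h n`. The relation `Realizes x h b` records this situation; the map `ι` sends the
class of `h` to the component of any `b` which `h` realizes. Path lifting yields such a `b` for
every `h` (`exists_realizes`). Another choice of the paths `γ` changes `h` by the twisted action
(`Realizes.exists_twist`, `Realizes.of_twist`). If `h` realizes both `b` and `b'`, then the paths
through the basepoints from `b n` to `b' n` are compatible up to homotopy, and homotopy lifting
deforms them into strictly compatible paths (`joined_of_classes`), so that `b` and `b'` are joined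
in the limit. Both lifting properties come from lifting homotopies which are stationary on a closed
set (`IsSerreFibration.lift_stationary`). Naturality is evident from the relation.

Multiplicativity has one source, `Realizes.mul`: pointwise multiplication of the paths `γ` shows
that a compatible family of multiplications of the spaces realizes the induced products of loop
classes. For positive `k` the multiplication is concatenation of cubes, for H-spaces it is the given
one; in both cases the Eckmann-Hilton argument identifies the induced product of loop classes with
the product of the homotopy group. Finally, for a group-like tower the coherent homotopies make
`π_0` of the limit a monoid, which is an extension of the group `lim π_0` by the group `lim¹ π_1`,
hence a group (`IsGroupLaw.of_extension`).
-/

noncomputable section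

/-! ### Serre fibrations -/

namespace IsSerreFibration

variable {E B : Type*} [TopologicalSpace E] [TopologicalSpace B] {p : C(E, B)}

theorem lift_of_homeomorph (hp : IsSerreFibration p) {Z : Type*} [TopologicalSpace Z] {n : ℕ}
    (e : Z ≃ₜ (Fin n → I)) (f : C(Z, E)) (H : C(I × Z, B)) (h0 : ∀ z, H (0, z) = p (f z)) :
    ∃ K : C(I × Z, E), (∀ z, K (0, z) = f z) ∧ ∀ y, p (K y) = H y := by
  obtain ⟨K, hK0, hK⟩ := hp n (f.comp e.symm)
    (H.comp ⟨fun y => (y.1, e.symm y.2), by fun_prop⟩) (fun a => h0 _)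
  refine ⟨K.comp ⟨fun y => (y.1, e y.2), by fun_prop⟩, fun z => ?_, fun y => ?_⟩
  · simpa using hK0 (e z)
  · simpa using hK (y.1, e y.2)

/-- A homotopy which is stationary on the zero set of `φ` has a lift which is stationary there:
lift the homotopy run at speed `1 / φ` and then slow the lift down by the factor `φ`. -/
theorem lift_stationary (hp : IsSerreFibration p) {Z : Type*} [TopologicalSpace Z] {n : ℕ}
    (e : Z ≃ₜ (Fin n → I)) (φ : C(Z, I)) (f : C(Z, E)) (H : C(I × Z, B))
    (h0 : ∀ z, H (0, z) = p (f z)) (hφ : ∀ t z, φ z = 0 → H (t, z) = p (f z)) :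
    ∃ K : C(I × Z, E), (∀ z, K (0, z) = f z) ∧ (∀ t z, φ z = 0 → K (t, z) = f z) ∧
      ∀ y, p (K y) = H y := by
  -- where `φ` vanishes, division by zero makes `c` zero; there `H` does not depend on time anyway
  let c : I × Z → I := fun y => Set.projIcc 0 1 zero_le_one ((y.1 : ℝ) / (φ y.2 : ℝ))
  have hG : Continuous fun y : I × Z => H (c y, y.2) := by
    rw [continuous_iff_continuousAt]
    rintro ⟨τ, z⟩
    by_cases hz : φ z = 0
    · -- `c` need not be continuous here, but `H` is almost constant in time near `z`
      intro U hU
      have hU' : ∀ t : I, U ∈ 𝓝 (H (t, z)) := fun t => by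
        have : H (c (τ, z), z) = H (t, z) := by rw [hφ _ z hz, hφ _ z hz]
        exact this ▸ hU
      have h1 : ∀ᶠ w in 𝓝 z, ∀ t ∈ (Set.univ : Set I), H (t, w) ∈ U := by
        refine isCompact_univ.eventually_forall_of_forall_eventually fun t _ => ?_
        have h2 : ContinuousAt (fun q : Z × I => H (q.2, q.1)) (z, t) := by fun_prop
        exact h2 (hU' t)
      have h3 : ∀ᶠ y in 𝓝 ((τ, z) : I × Z), ∀ t ∈ (Set.univ : Set I), H (t, y.2) ∈ U :=
        (continuous_snd.tendsto (τ, z)).eventually h1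
      exact h3.mono fun y hy => hy _ trivial
    · have hz' : (φ z : ℝ) ≠ 0 := fun h => hz (Subtype.ext h)
      have h1 : ContinuousAt (fun y : I × Z => (y.1 : ℝ) / (φ y.2 : ℝ)) (τ, z) :=
        ContinuousAt.div (by fun_prop) (by fun_prop) hz'
      have h2 : ContinuousAt c (τ, z) :=
        ContinuousAt.comp (g := Set.projIcc (0 : ℝ) 1 zero_le_one)
          continuous_projIcc.continuousAt h1
      exact H.continuous.continuousAt.comp (h2.prodMk continuous_snd.continuousAt)
  obtain ⟨K, hK0, hK⟩ := hp.lift_of_homeomorph e f ⟨_, hG⟩ (fun z => by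
    have : c (0, z) = 0 := by simp [c]
    simp [this, h0])
  refine ⟨K.comp ⟨fun y => (y.1 * φ y.2, y.2), by fun_prop⟩, fun z => ?_, fun t z hz => ?_,
    fun y => ?_⟩
  · simpa using hK0 z
  · simpa [hz] using hK0 z
  · obtain ⟨t, z⟩ := y
    refine (hK _).trans ?_
    by_cases hz : φ z = 0
    · exact (hφ _ z hz).trans (hφ _ z hz).symm
    · have hz' : (φ z : ℝ) ≠ 0 := fun h => hz (Subtype.ext h)
      have : c (t * φ z, z) = t := by
        simp [c, hz']
      simp [this]

/-- Path lifting. -/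
theorem exists_path_lift (hp : IsSerreFibration p) {e : E} {b b' : B} (h : p e = b)
    (β : Path b b') : ∃ (e' : E) (_ : p e' = b') (α : Path e e'), ∀ t, p (α t) = β t := by
  obtain ⟨K, hK0, hK⟩ := hp 0 (ContinuousMap.const _ e)
    ⟨fun y => β y.1, by fun_prop⟩ (fun a => by simp [h])
  refine ⟨K (1, 0), by simp [hK], ⟨⟨fun t => K (t, 0), by fun_prop⟩, hK0 0, rfl⟩, fun t => ?_⟩
  simp [hK]

/-- A path homotopic, relative to its endpoints, to the image of `α` is the image of a path
homotopic to `α`, relative to its endpoints. -/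
theorem exists_homotopic_lift (hp : IsSerreFibration p) {e e' : E} {b b' : B} (h : p e = b)
    (h' : p e' = b') (α : Path e e') (β : Path b b')
    (H : ((α.map p.continuous).cast h.symm h'.symm).Homotopic β) :
    ∃ α' : Path e e', α.Homotopic α' ∧ ∀ t, p (α' t) = β t := by
  obtain ⟨H⟩ := H
  have hs : ∀ s : I, s * σ s = 0 → s ∈ ({0, 1} : Set I) := by
    intro s hs
    rcases mul_eq_zero.1 hs with h | h
    · exact Or.inl h
    · exact Or.inr (by simpa using h)
  obtain ⟨K, hK0, hKs, hK⟩ := hp.lift_stationary (Homeomorph.funUnique (Fin 1) I).symm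
    ⟨fun s => s * σ s, by fun_prop⟩ α.toContinuousMap H.toContinuousMap
    (fun s => H.apply_zero s) (fun t s h0 => H.eq_fst t (hs s h0))
  have hK00 : ∀ t, K (t, 0) = e := fun t => by simpa using hKs t 0 (by simp)
  have hK11 : ∀ t, K (t, 1) = e' := fun t => by simpa using hKs t 1 (by simp)
  refine ⟨⟨⟨fun s => K (1, s), by fun_prop⟩, hK00 1, hK11 1⟩, ⟨⟨⟨K, hK0, fun s => rfl⟩, ?_⟩⟩,
    fun t => (hK _).trans (H.apply_one t)⟩
  rintro t s (rfl | rfl)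
  · simpa using hK00 t
  · simpa using hK11 t

end IsSerreFibration

/-- The map of spaces of based cubes induced by a based map. -/
def loopMap {N X Y : Type*} [TopologicalSpace X] [TopologicalSpace Y] {x : X} {y : Y}
    (f : C(X, Y)) (h : f x = y) : C(GenLoop N X x, GenLoop N Y y) :=
  ⟨genLoopMap f h, ((ContinuousMap.continuous_postcomp f).comp
    continuous_subtype_val).subtype_mk _⟩

/-- Joint continuity suffices for a family of based cubes to be continuous. -/
theorem continuous_genLoop_mk {Z N X : Type*} [TopologicalSpace Z] [TopologicalSpace X] {x : X}
    (F : Z → GenLoop N X x) (hF : Continuous fun y : Z × (N → I) => F y.1 y.2) : Continuous F :=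
  Continuous.subtype_mk (f := fun z => (F z).1)
    (ContinuousMap.continuous_of_continuous_uncurry _ hF) _

/-- A function on the cube `I^k` which vanishes exactly on the boundary. -/
def boundaryFun (k : ℕ) : C(Fin k → I, I) :=
  ⟨fun u => ∏ i, (u i * σ (u i)), by fun_prop⟩

theorem boundaryFun_eq_zero_iff {k : ℕ} (u : Fin k → I) :
    boundaryFun k u = 0 ↔ u ∈ Cube.boundary (Fin k) := by
  have h : boundaryFun k u = ∏ i, (u i * σ (u i)) := rfl
  rw [h, Finset.prod_eq_zero_iff]
  simp [Cube.boundary, mul_eq_zero]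

/-- The map of `k`-fold loop spaces induced by a Serre fibration is a Serre fibration. -/
theorem IsSerreFibration.loopMap {E B : Type*} [TopologicalSpace E] [TopologicalSpace B]
    {p : C(E, B)} (hp : IsSerreFibration p) {e : E} {b : B} (h : p e = b) (k : ℕ) :
    IsSerreFibration (loopMap (N := Fin k) p h) := by
  intro m f H h0
  obtain ⟨K, hK0, hKs, hK⟩ := hp.lift_stationary (Fin.appendHomeomorph m k)
    ⟨fun z => boundaryFun k z.2, by fun_prop⟩
    ⟨fun z : (Fin m → I) × (Fin k → I) => f z.1 z.2, by fun_prop⟩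
    ⟨fun y : I × (Fin m → I) × (Fin k → I) => H (y.1, y.2.1) y.2.2, by fun_prop⟩
    (fun z => DFunLike.congr_fun (h0 z.1) z.2)
    (fun t z hz => by
      have hz := (boundaryFun_eq_zero_iff _).1 hz
      exact ((H (t, z.1)).2 _ hz).trans (((congrArg p ((f z.1).2 _ hz)).trans h).symm))
  have hf : ∀ t a u, u ∈ Cube.boundary (Fin k) → K (t, a, u) = e := fun t a u hu =>
    (hKs t (a, u) ((boundaryFun_eq_zero_iff u).2 hu)).trans ((f a).2 u hu)
  refine ⟨⟨fun y => ⟨⟨fun u => K (y.1, y.2, u), by fun_prop⟩, fun u hu => hf _ _ u hu⟩,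
    continuous_genLoop_mk _ ?_⟩, fun a => ?_, fun y => ?_⟩
  · change Continuous fun z : (I × (Fin m → I)) × (Fin k → I) => K (z.1.1, z.1.2, z.2)
    fun_prop
  · ext u
    exact hK0 (a, u)
  · ext u
    exact hK (y.1, y.2, u)

/-! ### Path classes -/

section PathClasses

open Path.Homotopic

variable {X Y Z : Type*} [TopologicalSpace X] [TopologicalSpace Y] [TopologicalSpace Z]

/-- The map on homotopy classes of paths induced by `f`, where the endpoints `f a` and `f b` are
renamed `a'` and `b'`. -/
def pushClass (f : C(X, Y)) {a b : X} {a' b' : Y} (ha : f a = a') (hb : f b = b')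
    (γ : Path.Homotopic.Quotient a b) : Path.Homotopic.Quotient a' b' :=
  (γ.map f).cast ha.symm hb.symm

theorem pushClass_mk (f : C(X, Y)) {a b : X} {a' b' : Y} (ha : f a = a') (hb : f b = b')
    (γ : Path a b) : pushClass f ha hb (.mk γ) =
      .mk ((γ.map f.continuous).cast ha.symm hb.symm) := rfl

theorem pushClass_trans (f : C(X, Y)) {a b c : X} {a' b' c' : Y} (ha : f a = a') (hb : f b = b')
    (hc : f c = c') (γ : Path.Homotopic.Quotient a b) (δ : Path.Homotopic.Quotient b c) :
    pushClass f ha hc (γ.trans δ) = (pushClass f ha hb γ).trans (pushClass f hb hc δ) := by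
  subst ha hb hc
  induction γ, δ using Path.Homotopic.Quotient.ind₂ with | mk γ δ =>
  rw [← Path.Homotopic.Quotient.mk_trans, pushClass_mk, pushClass_mk, pushClass_mk,
    ← Path.Homotopic.Quotient.mk_trans]
  exact congrArg _ (Path.map_trans γ δ f.continuous)

theorem pushClass_symm (f : C(X, Y)) {a b : X} {a' b' : Y} (ha : f a = a') (hb : f b = b')
    (γ : Path.Homotopic.Quotient a b) :
    pushClass f hb ha γ.symm = (pushClass f ha hb γ).symm := by
  subst ha hb
  induction γ using Path.Homotopic.Quotient.ind with | mk γ => rfl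

theorem pushClass_refl (f : C(X, Y)) {a : X} {a' : Y} (ha : f a = a') :
    pushClass f ha ha (.refl a) = .refl a' := by
  subst ha
  rfl

/-- Functoriality of `pushClass` for a commutative square, with all endpoints renamed. -/
theorem pushClass_comm {W : Type*} [TopologicalSpace W] (f : C(X, Y)) (g : C(Y, Z))
    (f' : C(X, W)) (g' : C(W, Z)) (h : ∀ a, g (f a) = g' (f' a))
    {a b : X} {a₁ b₁ : Y} {a₂ b₂ : W} {a' b' : Z}
    (ha₁ : f a = a₁) (hb₁ : f b = b₁) (ha₂ : f' a = a₂) (hb₂ : f' b = b₂)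
    (ga₁ : g a₁ = a') (gb₁ : g b₁ = b') (ga₂ : g' a₂ = a') (gb₂ : g' b₂ = b')
    (γ : Path.Homotopic.Quotient a b) :
    pushClass g ga₁ gb₁ (pushClass f ha₁ hb₁ γ) =
      pushClass g' ga₂ gb₂ (pushClass f' ha₂ hb₂ γ) := by
  induction γ using Path.Homotopic.Quotient.ind with | mk γ =>
  simp only [pushClass_mk]
  congr 1
  ext t
  exact h (γ t)

namespace Path.Homotopic.Quotient

@[simp]
theorem trans_symm_cancel_left {a b c : X} (γ : Path.Homotopic.Quotient a b)
    (δ : Path.Homotopic.Quotient a c) : γ.trans (γ.symm.trans δ) = δ := by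
  rw [← trans_assoc, trans_symm, refl_trans]

@[simp]
theorem symm_trans_cancel_left {a b c : X} (γ : Path.Homotopic.Quotient a b)
    (δ : Path.Homotopic.Quotient b c) : γ.symm.trans (γ.trans δ) = δ := by
  rw [← trans_assoc, symm_trans, refl_trans]

@[simp]
theorem symm_trans_eq {a b c : X} (γ : Path.Homotopic.Quotient a b)
    (δ : Path.Homotopic.Quotient b c) : (γ.trans δ).symm = δ.symm.trans γ.symm := by
  induction γ, δ using Path.Homotopic.Quotient.ind₂ with | mk γ δ =>
  rw [← mk_trans, ← mk_symm, ← mk_symm, ← mk_symm, ← mk_trans, Path.trans_symm]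

end Path.Homotopic.Quotient

/-- Interchange of concatenation with the product of paths induced by a map `m`. -/
theorem pushClass_prod_trans (m : C(X × Y, Z)) {a b c : X} {a' b' c' : Y} {u v w : Z}
    (hu : m (a, a') = u) (hv : m (b, b') = v) (hw : m (c, c') = w)
    (γ : Path.Homotopic.Quotient a b) (δ : Path.Homotopic.Quotient b c)
    (γ' : Path.Homotopic.Quotient a' b') (δ' : Path.Homotopic.Quotient b' c') :
    pushClass m hu hw (Path.Homotopic.prod (γ.trans δ) (γ'.trans δ')) =
      (pushClass m hu hv (Path.Homotopic.prod γ γ')).trans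
        (pushClass m hv hw (Path.Homotopic.prod δ δ')) := by
  rw [← pushClass_trans]
  congr 1
  exact (Path.Homotopic.comp_prod_eq_prod_comp _ _ _ _).symm

end PathClasses

/-! ### The sequence in degree zero, in terms of paths -/

namespace FibrationTower

variable {T : FibrationTower.{u}} {x : T.Lim}

/-- The loop classes `h n` at `x n` realize the point `b` of the limit if there are classes of
paths `γ n` from `b n` to `x n` such that `h n` measures the failure of `γ` to be compatible with
the maps of the tower: the image of `γ (n + 1)` followed by `h n` is `γ n`. Thus `b` represents the
image of `h` under `lim¹ π₁ → π₀ lim`. -/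
def Realizes (x : T.Lim) (h : ∀ n, Path.Homotopic.Quotient (x.1 n) (x.1 n)) (b : T.Lim) : Prop :=
  ∃ γ : ∀ n, Path.Homotopic.Quotient (b.1 n) (x.1 n),
    ∀ n, (pushClass (T.p n) (b.2 n) (x.2 n) (γ (n + 1))).trans (h n) = γ n

theorem exists_tower_seq {P : ℕ → Type*} (R : ∀ n, P n → P (n + 1) → Prop)
    (a₀ : P 0) (h : ∀ n a, ∃ b, R n a b) : ∃ s : ∀ n, P n, ∀ n, R n (s n) (s (n + 1)) := by
  choose f hf using h
  exact ⟨fun n => Nat.rec a₀ f n, fun n => hf n _⟩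

/-- Construct the points `b n` and paths to them one after the other, lifting at each step the
concatenation of `h n` with the path to `b n`. -/
theorem exists_realizes (x : T.Lim) (h : ∀ n, Path.Homotopic.Quotient (x.1 n) (x.1 n)) :
    ∃ b, Realizes x h b := by
  obtain ⟨s, hs⟩ := exists_tower_seq
    (P := fun n => Σ b : T.X n, Path (x.1 n) b)
    (fun n a c => ∃ e : T.p n c.1 = a.1,
      pushClass (T.p n) (x.2 n) e (.mk c.2) = (h n).trans (.mk a.2))
    ⟨_, Path.refl _⟩ (fun n a => by
      obtain ⟨β, hβ⟩ := Path.Homotopic.Quotient.mk_surjective ((h n).trans (.mk a.2))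
      obtain ⟨c, hc, α, hα⟩ := (T.fib n).exists_path_lift (x.2 n) β
      refine ⟨⟨c, α⟩, hc, ?_⟩
      rw [← hβ, pushClass_mk]
      congr 1
      ext t
      exact hα t)
  choose e he using hs
  refine ⟨⟨fun n => (s n).1, e⟩, fun n => (Path.Homotopic.Quotient.mk (s n).2).symm, fun n => ?_⟩
  rw [pushClass_symm, he n]
  simp

/-- A path in the limit, assembled from paths compatible with the maps of the tower. -/
theorem joined_of_paths {b b' : T.Lim} (γ : ∀ n, Path (b.1 n) (b'.1 n))
    (h : ∀ n t, T.p n (γ (n + 1) t) = γ n t) : Joined b b' :=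
  ⟨⟨⟨fun t => ⟨fun n => γ n t, fun n => h n t⟩,
    Continuous.subtype_mk (continuous_pi fun n => (γ n).continuous) _⟩,
    Subtype.ext (funext fun n => (γ n).source), Subtype.ext (funext fun n => (γ n).target)⟩⟩

/-- Compatible classes of paths are represented by compatible paths. -/
theorem joined_of_classes {b b' : T.Lim} (γ : ∀ n, Path.Homotopic.Quotient (b.1 n) (b'.1 n))
    (h : ∀ n, pushClass (T.p n) (b.2 n) (b'.2 n) (γ (n + 1)) = γ n) : Joined b b' := by
  obtain ⟨a₀, ha₀⟩ := Path.Homotopic.Quotient.mk_surjective (γ 0)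
  obtain ⟨s, hs⟩ := exists_tower_seq
    (P := fun n => {α : Path (b.1 n) (b'.1 n) // Path.Homotopic.Quotient.mk α = γ n})
    (fun n a c => ∀ t, T.p n (c.1 t) = a.1 t) ⟨a₀, ha₀⟩ (fun n a => by
      obtain ⟨c, hc⟩ := Path.Homotopic.Quotient.mk_surjective (γ (n + 1))
      obtain ⟨c', hcc, hc'⟩ := (T.fib n).exists_homotopic_lift (b.2 n) (b'.2 n) c a.1 (by
        refine Path.Homotopic.Quotient.exact ?_
        exact (congrArg (pushClass (T.p n) (b.2 n) (b'.2 n)) hc).trans ((h n).trans a.2.symm))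
      exact ⟨⟨c', (Path.Homotopic.Quotient.eq.2 hcc).symm.trans hc⟩, hc'⟩)
  exact joined_of_paths (fun n => (s n).1) hs

/-- A compatible family of path components comes from a point of the limit. -/
theorem exists_lim_joined (a : ∀ n, T.X n) (h : ∀ n, Joined (T.p n (a (n + 1))) (a n)) :
    ∃ b : T.Lim, ∀ n, Joined (a n) (b.1 n) := by
  obtain ⟨s, hs⟩ := exists_tower_seq (P := fun n => {b : T.X n // Joined (a n) b})
    (fun n b c => T.p n c.1 = b.1) ⟨a 0, Joined.refl _⟩ (fun n b => by
      obtain ⟨β⟩ := (h n).trans b.2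
      obtain ⟨c, hc, α, -⟩ := (T.fib n).exists_path_lift rfl β
      exact ⟨⟨c, ⟨α⟩⟩, hc⟩)
  exact ⟨⟨fun n => (s n).1, hs⟩, fun n => (s n).2⟩

theorem proj_apply (T : FibrationTower.{u}) (n : ℕ) (b : T.Lim) : T.proj n b = b.1 n := rfl

theorem Hom.lim_apply {T' : FibrationTower.{u}} (F : T.Hom T') (b : T.Lim) (n : ℕ) :
    F.f n (b.1 n) = (F.lim b).1 n := rfl

namespace Realizes

variable {h h' : ∀ n, Path.Homotopic.Quotient (x.1 n) (x.1 n)} {b b' : T.Lim}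

protected theorem refl (x : T.Lim) : Realizes x (fun _ => .refl _) x :=
  ⟨fun _ => .refl _, fun n => by rw [pushClass_refl]; simp⟩

theorem of_joined (H : Realizes x h b) (hb : Joined b b') : Realizes x h b' := by
  obtain ⟨γ, hγ⟩ := H
  obtain ⟨β⟩ := hb
  let β' : ∀ n, Path.Homotopic.Quotient (b.1 n) (b'.1 n) := fun n =>
    pushClass (T.proj n) (T.proj_apply n b) (T.proj_apply n b') (.mk β)
  have hβ : ∀ n, pushClass (T.p n) (b.2 n) (b'.2 n) (β' (n + 1)) = β' n := by
    intro n
    refine congrArg Path.Homotopic.Quotient.mk (Path.ext (funext fun t => ?_))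
    exact (β t).2 n
  refine ⟨fun n => (β' n).symm.trans (γ n), fun n => ?_⟩
  beta_reduce
  rw [pushClass_trans _ (b'.2 n) (b.2 n), pushClass_symm, hβ, ← hγ n]
  simp

/-- A sequence of loop classes determines the path component which it realizes. -/
theorem joined (H : Realizes x h b) (H' : Realizes x h b') : Joined b b' := by
  obtain ⟨γ, hγ⟩ := H
  obtain ⟨γ', hγ'⟩ := H'
  refine joined_of_classes (fun n => (γ n).trans (γ' n).symm) fun n => ?_
  rw [pushClass_trans _ (b.2 n) (x.2 n), pushClass_symm, ← hγ n, ← hγ' n]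
  simp

/-- Two sequences which realize the same point are related by the twisted action. -/
theorem exists_twist (H : Realizes x h b) (H' : Realizes x h' b) :
    ∃ g : ∀ n, Path.Homotopic.Quotient (x.1 n) (x.1 n), ∀ n,
      h n = (pushClass (T.p n) (x.2 n) (x.2 n) (g (n + 1))).symm.trans ((h' n).trans (g n)) := by
  obtain ⟨γ, hγ⟩ := H
  obtain ⟨γ', hγ'⟩ := H'
  refine ⟨fun n => (γ' n).symm.trans (γ n), fun n => ?_⟩
  beta_reduce
  rw [pushClass_trans _ (x.2 n) (b.2 n), pushClass_symm, ← hγ n, ← hγ' n]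
  simp

/-- A sequence in the same orbit of the twisted action realizes the same point. -/
theorem of_twist (H : Realizes x h b) (g : ∀ n, Path.Homotopic.Quotient (x.1 n) (x.1 n))
    (hg : ∀ n, h n =
      (pushClass (T.p n) (x.2 n) (x.2 n) (g (n + 1))).symm.trans ((h' n).trans (g n))) :
    Realizes x h' b := by
  obtain ⟨γ, hγ⟩ := H
  refine ⟨fun n => (γ n).trans (g n).symm, fun n => ?_⟩
  beta_reduce
  rw [pushClass_trans _ (b.2 n) (x.2 n), pushClass_symm, ← hγ n, hg n]
  simp

theorem joined_apply (H : Realizes x h b) (n : ℕ) : Joined (b.1 n) (x.1 n) := by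
  obtain ⟨γ, -⟩ := H
  obtain ⟨γ, -⟩ := Path.Homotopic.Quotient.mk_surjective (γ n)
  exact ⟨γ⟩

theorem map {T' : FibrationTower.{u}} (F : T.Hom T') {y : T'.Lim} (hy : F.lim x = y)
    (H : Realizes x h b) :
    Realizes y (fun n => pushClass (F.f n) (congrFun (congrArg Subtype.val hy) n)
      (congrFun (congrArg Subtype.val hy) n) (h n)) (F.lim b) := by
  subst hy
  obtain ⟨γ, hγ⟩ := H
  refine ⟨fun n => pushClass (F.f n) (F.lim_apply b n) (F.lim_apply x n) (γ n), fun n => ?_⟩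
  beta_reduce
  rw [← hγ n, pushClass_trans _ _ (F.lim_apply x n) _]
  congr 1
  exact pushClass_comm _ _ _ _ (fun a => (F.comm n a).symm) _ _ _ _ _ _ _ _ _

/-- Multiplications of the spaces of the tower, compatible with its maps, multiply realizations
pointwise. -/
theorem mul (m : ∀ n, C(T.X n × T.X n, T.X n)) (hx : ∀ n, m n (x.1 n, x.1 n) = x.1 n)
    (hm : ∀ n a a', T.p n (m (n + 1) (a, a')) = m n (T.p n a, T.p n a'))
    {c : T.Lim} (hc : ∀ n, m n (b.1 n, b'.1 n) = c.1 n)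
    (H : Realizes x h b) (H' : Realizes x h' b') :
    Realizes x (fun n => pushClass (m n) (hx n) (hx n) (Path.Homotopic.prod (h n) (h' n))) c := by
  obtain ⟨γ, hγ⟩ := H
  obtain ⟨γ', hγ'⟩ := H'
  refine ⟨fun n => pushClass (m n) (hc n) (hx n) (Path.Homotopic.prod (γ n) (γ' n)), fun n => ?_⟩
  beta_reduce
  rw [← hγ n, ← hγ' n, pushClass_prod_trans (m n) (hc n) (hx n) (hx n)]
  congr 1
  generalize γ (n + 1) = δ
  generalize γ' (n + 1) = δ'
  induction δ, δ' using Path.Homotopic.Quotient.ind₂ with | mk δ δ' =>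
  simp only [pushClass_mk, Path.Homotopic.prod_lift]
  congr 1
  ext t
  exact hm n _ _

end Realizes

/-- A point of the limit whose coordinates are joined to the basepoints is realized. -/
theorem exists_realizes_of_joined {b : T.Lim} (H : ∀ n, Joined (b.1 n) (x.1 n)) :
    ∃ h, Realizes x h b := by
  let γ := fun n => (H n).somePath
  refine ⟨fun n => (pushClass (T.p n) (b.2 n) (x.2 n) (.mk (γ (n + 1)))).symm.trans (.mk (γ n)),
    fun n => .mk (γ n), fun n => ?_⟩
  simp

end FibrationTower

/-! ### Based cubes as loops of based cubes -/

section LoopClass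

variable {X Y : Type*} [TopologicalSpace X] [TopologicalSpace Y] {x : X} {y : Y} {k : ℕ}

theorem genLoop_homotopic_iff_joined {N : Type*} {f g : GenLoop N X x} :
    GenLoop.Homotopic f g ↔ Joined f g := by
  constructor
  · rintro ⟨H⟩
    refine ⟨⟨⟨fun t => ⟨⟨fun u => H (t, u), by fun_prop⟩, fun u hu => ?_⟩,
      continuous_genLoop_mk _ ?_⟩, ?_, ?_⟩⟩
    · exact (H.eq_fst t hu).trans (f.2 u hu)
    · exact H.continuous
    · ext u
      exact H.apply_zero u
    · ext u
      exact H.apply_one u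
  · rintro ⟨γ⟩
    refine ⟨⟨⟨⟨fun z => γ z.1 z.2, by fun_prop⟩, fun u => ?_, fun u => ?_⟩, fun t u hu => ?_⟩⟩
    · exact DFunLike.congr_fun γ.source u
    · exact DFunLike.congr_fun γ.target u
    · exact ((γ t).2 u hu).trans (f.2 u hu).symm

/-- A based `(k + 1)`-cube as a loop of based `k`-cubes, parametrized by the first coordinate. -/
def consLoop (f : GenLoop (Fin (k + 1)) X x) :
    Path (GenLoop.const : GenLoop (Fin k) X x) GenLoop.const where
  toFun t := ⟨⟨fun u => f (Fin.cons t u : Fin (k + 1) → I), by fun_prop⟩,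
    fun u ⟨i, hi⟩ => f.2 _ ⟨i.succ, by simpa using hi⟩⟩
  continuous_toFun := continuous_genLoop_mk _ <| by
    change Continuous fun z : I × (Fin k → I) => f (Fin.cons z.1 z.2 : Fin (k + 1) → I)
    fun_prop
  source' := by
    ext u
    exact f.2 _ ⟨0, Or.inl rfl⟩
  target' := by
    ext u
    exact f.2 _ ⟨0, Or.inr rfl⟩

theorem consLoop_apply (f : GenLoop (Fin (k + 1)) X x) (t : I) (u : Fin k → I) :
    consLoop f t u = f (Fin.cons t u : Fin (k + 1) → I) := rfl

theorem consLoop_surjective : Function.Surjective (consLoop (X := X) (x := x) (k := k)) := by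
  intro γ
  refine ⟨⟨⟨fun u => γ (u 0) (Fin.tail u), ?_⟩, ?_⟩, ?_⟩
  · unfold Fin.tail
    fun_prop
  · rintro u ⟨i, hi⟩
    change γ (u 0) (Fin.tail u) = x
    induction i using Fin.cases with
    | zero =>
      rcases hi with hi | hi
      · rw [hi, γ.source]
        rfl
      · rw [hi, γ.target]
        rfl
    | succ i => exact (γ (u 0)).2 _ ⟨i, hi⟩
  · ext t u
    rfl

theorem homotopic_consLoop_iff (f g : GenLoop (Fin (k + 1)) X x) :
    (consLoop f).Homotopic (consLoop g) ↔ GenLoop.Homotopic f g := by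
  constructor
  · rintro ⟨H⟩
    refine ⟨⟨⟨⟨fun z => H (z.1, z.2 0) (Fin.tail z.2), ?_⟩, fun u => ?_, fun u => ?_⟩,
      fun t u hu => ?_⟩⟩
    · unfold Fin.tail
      fun_prop
    · refine (DFunLike.congr_fun (H.apply_zero (u 0)) (Fin.tail u)).trans ?_
      exact congrArg f (Fin.cons_self_tail u)
    · refine (DFunLike.congr_fun (H.apply_one (u 0)) (Fin.tail u)).trans ?_
      exact congrArg g (Fin.cons_self_tail u)
    · change H (t, u 0) (Fin.tail u) = f u
      refine Eq.trans ?_ (f.2 u hu).symm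
      obtain ⟨i, hi⟩ := hu
      induction i using Fin.cases with
      | zero =>
        rcases hi with hi | hi
        · rw [hi, H.source]
          rfl
        · rw [hi, H.target]
          rfl
      | succ i => exact (H (t, u 0)).2 _ ⟨i, hi⟩
  · rintro ⟨H⟩
    refine ⟨⟨⟨⟨fun z => ⟨⟨fun u => H (z.1, (Fin.cons z.2 u : Fin (k + 1) → I)), by fun_prop⟩, ?_⟩,
      continuous_genLoop_mk _ ?_⟩, fun s => ?_, fun s => ?_⟩, fun t s hs => ?_⟩⟩
    · rintro u ⟨i, hi⟩
      have hu : (Fin.cons z.2 u : Fin (k + 1) → I) ∈ Cube.boundary (Fin (k + 1)) :=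
        ⟨i.succ, by simpa using hi⟩
      exact (H.eq_fst z.1 hu).trans (f.2 _ hu)
    · change Continuous fun y : (I × I) × (Fin k → I) =>
        H (y.1.1, (Fin.cons y.1.2 y.2 : Fin (k + 1) → I))
      fun_prop
    · ext u
      exact H.apply_zero _
    · ext u
      exact H.apply_one _
    · ext u
      exact H.eq_fst t ⟨0, hs⟩

theorem consLoop_transAt_zero (f g : GenLoop (Fin (k + 1)) X x) :
    consLoop (GenLoop.transAt 0 f g) = (consLoop f).trans (consLoop g) := by
  ext t u
  rw [Path.trans_apply, consLoop_apply, GenLoop.transAt, GenLoop.coe_copy]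
  simp only [Fin.cons_zero, Fin.update_cons_zero]
  split_ifs with h
  · rw [consLoop_apply, Set.projIcc_of_mem]
  · rw [consLoop_apply, Set.projIcc_of_mem]

theorem consLoop_transAt_one (f g : GenLoop (Fin (k + 1 + 1)) X x) (t : I) :
    consLoop (GenLoop.transAt 1 f g) t = GenLoop.transAt 0 (consLoop f t) (consLoop g t) := by
  ext u
  rw [consLoop_apply, GenLoop.transAt, GenLoop.coe_copy, GenLoop.transAt, GenLoop.coe_copy]
  have h1 : (Fin.cons t u : Fin (k + 1 + 1) → I) 1 = u 0 := rfl
  have h2 : ∀ v : I, Function.update (Fin.cons t u : Fin (k + 1 + 1) → I) 1 v =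
      Fin.cons t (Function.update u 0 v) := fun v =>
    (Fin.cons_update (α := fun _ => I) t u 0 v).symm
  simp only [h1, h2, consLoop_apply]

/-- The identification of `π_{k+1}(X)` with the loop classes at the constant cube in the space of
based `k`-cubes. -/
def loopClass : π_ (k + 1) X x →
    Path.Homotopic.Quotient (GenLoop.const : GenLoop (Fin k) X x) GenLoop.const :=
  Quotient.map consLoop fun f g => (homotopic_consLoop_iff f g).2

theorem loopClass_injective : Function.Injective (loopClass (X := X) (x := x) (k := k)) := by
  intro a b
  refine Quotient.inductionOn₂ a b fun f g h => Quotient.sound ?_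
  exact (homotopic_consLoop_iff f g).1 (Path.Homotopic.Quotient.exact h)

theorem loopClass_surjective : Function.Surjective (loopClass (X := X) (x := x) (k := k)) := by
  intro γ
  obtain ⟨γ, rfl⟩ := Path.Homotopic.Quotient.mk_surjective γ
  obtain ⟨f, rfl⟩ := consLoop_surjective γ
  exact ⟨Quotient.mk _ f, rfl⟩

/-- The product `a * b` of homotopy groups is the concatenation of `b` followed by `a`. -/
theorem loopClass_mul (a b : π_ (k + 1) X x) :
    loopClass (a * b) = (loopClass b).trans (loopClass a) := by
  refine Quotient.inductionOn₂ a b fun f g => ?_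
  refine (congrArg loopClass (HomotopyGroup.mul_spec (i := 0) (p := f) (q := g))).trans ?_
  exact congrArg Path.Homotopic.Quotient.mk (consLoop_transAt_zero g f)

theorem loopClass_one : loopClass (1 : π_ (k + 1) X x) = .refl _ := by
  rw [HomotopyGroup.one_def]
  refine congrArg Path.Homotopic.Quotient.mk ?_
  ext t u
  rfl

theorem loopClass_inv (a : π_ (k + 1) X x) : loopClass a⁻¹ = (loopClass a).symm := by
  have h := loopClass_mul a a⁻¹
  rw [mul_inv_cancel, loopClass_one] at h
  have h' := congrArg (fun γ => γ.trans (loopClass a).symm) h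
  simpa using h'.symm

theorem loopMap_const (f : C(X, Y)) (h : f x = y) :
    loopMap (N := Fin k) f h GenLoop.const = GenLoop.const := by
  ext u
  exact h

theorem loopClass_piMap (f : C(X, Y)) (h : f x = y) (a : π_ (k + 1) X x) :
    loopClass (piMap (k + 1) f h a) =
      pushClass (loopMap f h) (loopMap_const f h) (loopMap_const f h) (loopClass a) :=
  Quotient.inductionOn a fun _ => rfl

/-- Concatenation of based `(k + 1)`-cubes along the first coordinate; in the order which makes it
represent the product of `π_{k+1}`. -/
def loopMul (X : Type*) [TopologicalSpace X] (x : X) (k : ℕ) :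
    C(GenLoop (Fin (k + 1)) X x × GenLoop (Fin (k + 1)) X x, GenLoop (Fin (k + 1)) X x) :=
  ⟨fun z => GenLoop.transAt 0 z.2 z.1, by
    simp only [← GenLoop.fromLoop_trans_toLoop]
    have h := GenLoop.continuous_toLoop (X := X) (x := x) (0 : Fin (k + 1))
    exact (GenLoop.continuous_fromLoop 0).comp
      (Path.continuous_trans.comp
      ((h.comp continuous_snd).prodMk (h.comp continuous_fst)))⟩

end LoopClass

/-- Concatenating loops of cubes pointwise is concatenation of cubes along the second coordinate,
which represents the product of the homotopy group as well. -/
theorem pushClass_loopMul {X : Type*} [TopologicalSpace X] {x : X} {k : ℕ}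
    (h : loopMul X x k (GenLoop.const, GenLoop.const) = GenLoop.const)
    (a b : π_ (k + 1 + 1) X x) :
    pushClass (loopMul X x k) h h (Path.Homotopic.prod (loopClass a) (loopClass b)) =
      loopClass (a * b) := by
  refine Quotient.inductionOn₂ a b fun f g => ?_
  refine Eq.trans ?_ (congrArg loopClass
    (HomotopyGroup.mul_spec (i := (1 : Fin (k + 1 + 1))) (p := f) (q := g))).symm
  refine congrArg Path.Homotopic.Quotient.mk (Path.ext (funext fun t => ?_))
  exact (consLoop_transAt_one g f t).symm

theorem loopMul_const (X : Type*) [TopologicalSpace X] (x : X) (k : ℕ) :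
    loopMul X x k (GenLoop.const, GenLoop.const) = GenLoop.const := by
  ext u
  change GenLoop.transAt 0 GenLoop.const GenLoop.const u = x
  rw [GenLoop.transAt, GenLoop.coe_copy]
  simp

theorem loopMap_loopMul {X Y : Type*} [TopologicalSpace X] [TopologicalSpace Y] {x : X} {y : Y}
    (f : C(X, Y)) (h : f x = y) {k : ℕ} (a b : GenLoop (Fin (k + 1)) X x) :
    loopMap f h (loopMul X x k (a, b)) = loopMul Y y k (loopMap f h a, loopMap f h b) := by
  ext u
  change f (GenLoop.transAt 0 b a u) = GenLoop.transAt 0 (loopMap f h b) (loopMap f h a) u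
  simp only [GenLoop.transAt, GenLoop.coe_copy]
  split_ifs <;> rfl

/-! ### The tower of spaces of based cubes -/

namespace FibrationTower

variable (T : FibrationTower.{u}) (x : T.Lim) (k : ℕ)

/-- The tower of the spaces of based `k`-cubes. -/
abbrev loopTower : FibrationTower.{u} where
  X n := GenLoop (Fin k) (T.X n) (x.1 n)
  top _ := inferInstance
  p n := loopMap (T.p n) (x.2 n)
  fib n := (T.fib n).loopMap (x.2 n) k

/-- The constant cubes. -/
abbrev loopBase : (T.loopTower x k).Lim :=
  ⟨fun _ => GenLoop.const, fun n => loopMap_const (T.p n) (x.2 n)⟩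

variable {T x k}

/-- The coordinates of a based cube in the limit. -/
def toLoopLim (b : GenLoop (Fin k) T.Lim x) : (T.loopTower x k).Lim :=
  ⟨fun n => loopMap (T.proj n) rfl b, fun n => by
    apply GenLoop.ext
    intro u
    exact (b u).2 n⟩

/-- The based cube in the limit with given coordinates. -/
def ofLoopLim (b : (T.loopTower x k).Lim) : GenLoop (Fin k) T.Lim x :=
  ⟨⟨fun u => ⟨fun n => (b.1 n : GenLoop (Fin k) (T.X n) (x.1 n)) u,
      fun n => DFunLike.congr_fun (F := GenLoop (Fin k) (T.X n) (x.1 n)) (b.2 n) u⟩,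
    Continuous.subtype_mk (continuous_pi fun n =>
      (b.1 n : GenLoop (Fin k) (T.X n) (x.1 n)).1.continuous) _⟩,
    fun u hu => Subtype.ext (funext fun n =>
      (b.1 n : GenLoop (Fin k) (T.X n) (x.1 n)).2 u hu)⟩

theorem continuous_toLoopLim : Continuous (toLoopLim (T := T) (x := x) (k := k)) :=
  Continuous.subtype_mk (continuous_pi fun n => (loopMap (T.proj n) rfl).continuous) _

theorem continuous_ofLoopLim : Continuous (ofLoopLim (T := T) (x := x) (k := k)) := by
  refine continuous_genLoop_mk _ (Continuous.subtype_mk (continuous_pi fun n => ?_) _)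
  have h : Continuous fun b : (T.loopTower x k).Lim =>
      (b.1 n : GenLoop (Fin k) (T.X n) (x.1 n)) := ((T.loopTower x k).proj n).continuous
  exact (h.comp continuous_fst).eval continuous_snd

theorem joined_toLoopLim_iff {b b' : GenLoop (Fin k) T.Lim x} :
    Joined (toLoopLim b) (toLoopLim b') ↔ GenLoop.Homotopic b b' := by
  rw [genLoop_homotopic_iff_joined]
  exact ⟨fun h => h.map continuous_ofLoopLim, fun h => h.map continuous_toLoopLim⟩

/-- The cube `b` of the limit realizes the sequence `h` of elements of `π_{k+1}`, that is, its class
is the image of the class of `h` under `lim¹ π_{k+1} → π_k lim`. -/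
def RealizesPi (h : ∀ n, T.PiGroup x k n) (b : GenLoop (Fin k) T.Lim x) : Prop :=
  Realizes (T.loopBase x k) (fun n => loopClass (h n)) (toLoopLim b)

theorem exists_realizesPi (h : ∀ n, T.PiGroup x k n) :
    ∃ b : GenLoop (Fin k) T.Lim x, RealizesPi h b := by
  obtain ⟨b, hb⟩ := exists_realizes (T.loopBase x k) fun n => loopClass (h n)
  exact ⟨ofLoopLim b, hb⟩

/-- The orbit relation which defines `lim¹`, in terms of loop classes. -/
theorem limOne_mk_eq_iff (h h' : ∀ n, T.PiGroup x k n) :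
    (LimOne.mk (G := T.PiGroup x k) (T.piTower x k) h = LimOne.mk (T.piTower x k) h') ↔
      ∃ g : ∀ n, Path.Homotopic.Quotient ((T.loopBase x k).1 n) ((T.loopBase x k).1 n), ∀ n,
        loopClass (h n) = (pushClass ((T.loopTower x k).p n) ((T.loopBase x k).2 n)
          ((T.loopBase x k).2 n) (g (n + 1))).symm.trans ((loopClass (h' n)).trans (g n)) := by
  have key : ∀ (g : ∀ n, T.PiGroup x k n) (n : ℕ),
      loopClass (g n * h' n * T.piTower x k n ((g (n + 1))⁻¹)) =
        (pushClass ((T.loopTower x k).p n) ((T.loopBase x k).2 n)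
          ((T.loopBase x k).2 n) (loopClass (g (n + 1)))).symm.trans
            ((loopClass (h' n)).trans (loopClass (g n))) := by
    intro g n
    rw [loopClass_mul, loopClass_mul, map_inv, loopClass_inv]
    congr 2
    exact loopClass_piMap _ _ _
  rw [LimOne.mk_eq_iff]
  constructor
  · rintro ⟨g, hg⟩
    exact ⟨fun n => loopClass (g n), fun n => (congrArg loopClass (hg n)).symm.trans (key g n)⟩
  · rintro ⟨g, hg⟩
    choose g' hg' using fun n => loopClass_surjective (X := T.X n) (x := x.1 n) (k := k) (g n)
    refine ⟨g', fun n => loopClass_injective ?_⟩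
    rw [key, hg n, hg', hg']

namespace RealizesPi

variable {h h' : ∀ n, T.PiGroup x k n} {b b' : GenLoop (Fin k) T.Lim x}

theorem of_homotopic (H : RealizesPi h b) (hb : GenLoop.Homotopic b b') : RealizesPi h b' :=
  Realizes.of_joined H (joined_toLoopLim_iff.2 hb)

/-- The class in `lim¹` determines the class of a realizing cube. -/
theorem homotopic (H : RealizesPi h b) (H' : RealizesPi h' b')
    (hh : LimOne.mk (G := T.PiGroup x k) (T.piTower x k) h = LimOne.mk (T.piTower x k) h') :
    GenLoop.Homotopic b b' := by
  obtain ⟨g, hg⟩ := (limOne_mk_eq_iff h h').1 hh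
  exact joined_toLoopLim_iff.1 (Realizes.joined (Realizes.of_twist H g hg) H')

/-- The class of a cube determines the class in `lim¹` of the sequences which it realizes. -/
theorem limOne_eq (H : RealizesPi h b) (H' : RealizesPi h' b') (hb : GenLoop.Homotopic b b') :
    LimOne.mk (G := T.PiGroup x k) (T.piTower x k) h = LimOne.mk (T.piTower x k) h' :=
  (limOne_mk_eq_iff h h').2 (Realizes.exists_twist (H.of_homotopic hb) H')

protected theorem one : RealizesPi (T := T) (x := x) (k := k) 1 GenLoop.const := by
  have h : (fun n => loopClass ((1 : ∀ n, T.PiGroup x k n) n)) = fun n => .refl _ :=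
    funext fun n => loopClass_one
  unfold RealizesPi
  rw [h]
  exact Realizes.refl _

theorem map {T' : FibrationTower.{u}} (F : T.Hom T') (H : RealizesPi h b) :
    RealizesPi (T := T') (x := F.lim x) (fun n => piHom k (F.f n) rfl (h n))
      (genLoopMap F.lim rfl b) := by
  let F' : (T.loopTower x k).Hom (T'.loopTower (F.lim x) k) :=
    { f := fun n => loopMap (F.f n) rfl
      comm := fun n a => by
        apply GenLoop.ext
        intro u
        exact F.comm n _ }
  have hF : F'.lim (T.loopBase x k) = T'.loopBase (F.lim x) k := rfl
  have h1 : (fun n => loopClass (piHom k (F.f n) rfl (h n))) = _ :=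
    funext fun n => loopClass_piMap (F.f n) rfl (h n)
  exact Eq.mpr (congrArg (fun h => Realizes (T'.loopBase (F.lim x) k) h
    (toLoopLim (genLoopMap F.lim rfl b))) h1) (Realizes.map F' hF H)

/-- Cubes which are multiplied pointwise by maps representing the product of `π_{k+1}` realize
products. -/
theorem mul (m : ∀ n, C(GenLoop (Fin k) (T.X n) (x.1 n) × GenLoop (Fin k) (T.X n) (x.1 n),
      GenLoop (Fin k) (T.X n) (x.1 n)))
    (hx : ∀ n, m n (GenLoop.const, GenLoop.const) = GenLoop.const)
    (hm : ∀ n a a', loopMap (T.p n) (x.2 n) (m (n + 1) (a, a')) =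
      m n (loopMap (T.p n) (x.2 n) a, loopMap (T.p n) (x.2 n) a'))
    (hmul : ∀ n (a a' : T.PiGroup x k n), pushClass (m n) (hx n) (hx n)
      (Path.Homotopic.prod (loopClass a) (loopClass a')) = loopClass (a * a'))
    {c : GenLoop (Fin k) T.Lim x}
    (hc : ∀ n, m n (loopMap (T.proj n) rfl b, loopMap (T.proj n) rfl b') =
      loopMap (T.proj n) rfl c)
    (H : RealizesPi h b) (H' : RealizesPi h' b') : RealizesPi (h * h') c := by
  have h1 : (fun n => loopClass ((h * h') n)) = _ :=
    funext fun n => (hmul n (h n) (h' n)).symm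
  unfold RealizesPi
  rw [h1]
  exact Realizes.mul (T := T.loopTower x k) m hx hm hc H H'

theorem piMap_proj (H : RealizesPi h b) (n : ℕ) :
    GenLoop.Homotopic (genLoopMap (T.proj n) rfl b) GenLoop.const :=
  genLoop_homotopic_iff_joined.2 (H.joined_apply n)

end RealizesPi

theorem exists_realizesPi_of_homotopic {b : GenLoop (Fin k) T.Lim x}
    (H : ∀ n, GenLoop.Homotopic (genLoopMap (T.proj n) rfl b)
      (GenLoop.const : GenLoop (Fin k) (T.X n) (x.1 n))) :
    ∃ h : ∀ n, T.PiGroup x k n, RealizesPi h b := by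
  obtain ⟨g, hg⟩ := exists_realizes_of_joined (x := T.loopBase x k) (b := toLoopLim b)
    fun n => genLoop_homotopic_iff_joined.1 (H n)
  choose h hh using fun n => loopClass_surjective (X := T.X n) (x := x.1 n) (k := k) (g n)
  refine ⟨h, ?_⟩
  obtain rfl : (fun n => loopClass (h n)) = g := funext hh
  exact hg

/-- Path lifting turns representatives which are compatible up to homotopy into compatible ones. -/
theorem toLimPi_surjective : Function.Surjective (T.toLimPi x k) := by
  rintro ⟨a, ha⟩
  choose f hf using fun n => Quotient.exists_rep (a n)
  obtain ⟨b, hb⟩ := exists_lim_joined (T := T.loopTower x k) f fun n => by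
    have h := ha n
    rw [← hf n, ← hf (n + 1)] at h
    exact genLoop_homotopic_iff_joined.1 (Quotient.exact h)
  refine ⟨Quotient.mk _ (ofLoopLim b), Subtype.ext (funext fun n => ?_)⟩
  refine Eq.trans ?_ (hf n)
  exact Quotient.sound (genLoop_homotopic_iff_joined.2 (hb n).symm)

end FibrationTower

/-! ### The short exact sequence -/

namespace FibrationTower

variable {T : FibrationTower.{u}} {x : T.Lim} {k : ℕ}

theorem limOne_mk_surjective (a : T.LimOnePi x k) :
    ∃ h : ∀ n, T.PiGroup x k n, LimOne.mk (T.piTower x k) h = a :=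
  Quotient.exists_rep a

/-- The map `lim¹ π_{k+1} → π_k lim`: the class of a sequence goes to the class of any cube which
realizes it. -/
def milnorMap (k : ℕ) (T : FibrationTower.{u}) (x : T.Lim) (a : T.LimOnePi x k) : π_ k T.Lim x :=
  Quotient.mk _ (exists_realizesPi (limOne_mk_surjective a).choose).choose

theorem milnorMap_mk {h : ∀ n, T.PiGroup x k n} {b : GenLoop (Fin k) T.Lim x}
    (H : RealizesPi h b) :
    milnorMap k T x (LimOne.mk (T.piTower x k) h) = Quotient.mk _ b :=
  Quotient.sound ((exists_realizesPi _).choose_spec.homotopic H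
    (limOne_mk_surjective (LimOne.mk (T.piTower x k) h)).choose_spec)

theorem exists_milnorMap_eq (a : T.LimOnePi x k) : ∃ (h : ∀ n, T.PiGroup x k n)
    (b : GenLoop (Fin k) T.Lim x), RealizesPi h b ∧ LimOne.mk (T.piTower x k) h = a ∧
      milnorMap k T x a = Quotient.mk _ b := by
  obtain ⟨h, rfl⟩ := limOne_mk_surjective a
  obtain ⟨b, hb⟩ := exists_realizesPi h
  exact ⟨h, b, hb, rfl, milnorMap_mk hb⟩

theorem milnorMap_limOneBase : milnorMap k T x (T.limOneBase x k) = piBase x k :=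
  milnorMap_mk .one

theorem toLimPi_piBase : T.toLimPi x k (piBase x k) = T.limPiBase x k := rfl

theorem milnorMap_injective : Function.Injective (milnorMap k T x) := by
  intro a a' haa
  obtain ⟨h, b, H, rfl, hb⟩ := exists_milnorMap_eq a
  obtain ⟨h', b', H', rfl, hb'⟩ := exists_milnorMap_eq a'
  rw [hb, hb'] at haa
  exact H.limOne_eq H' (Quotient.exact haa)

theorem toLimPi_eq_base_iff (b : π_ k T.Lim x) :
    T.toLimPi x k b = T.limPiBase x k ↔ b ∈ Set.range (milnorMap k T x) := by
  constructor
  · refine Quotient.inductionOn b fun b hb => ?_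
    obtain ⟨h, H⟩ := exists_realizesPi_of_homotopic (b := b) fun n =>
      Quotient.exact (congrFun (congrArg Subtype.val hb) n)
    exact ⟨_, milnorMap_mk H⟩
  · rintro ⟨a, rfl⟩
    obtain ⟨h, b, H, -, hb⟩ := exists_milnorMap_eq a
    rw [hb]
    exact Subtype.ext (funext fun n => Quotient.sound (H.piMap_proj n))

theorem isShortExactPointed (k : ℕ) (T : FibrationTower.{u}) (x : T.Lim) :
    IsShortExactPointed (T.limOneBase x k) (piBase x k) (T.limPiBase x k)
      (milnorMap k T x) (T.toLimPi x k) where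
  map_base_left := milnorMap_limOneBase
  map_base_right := toLimPi_piBase
  injective := milnorMap_injective
  exact := toLimPi_eq_base_iff
  surjective := toLimPi_surjective

theorem milnorMap_natural {T' : FibrationTower.{u}} (F : T.Hom T') (a : T.LimOnePi x k) :
    milnorMap k T' (F.lim x) (F.limOnePi k a) = piMap k F.lim rfl (milnorMap k T x a) := by
  obtain ⟨h, b, H, rfl, hb⟩ := exists_milnorMap_eq a
  rw [hb]
  exact milnorMap_mk (H.map F)

theorem toLimPi_natural {T' : FibrationTower.{u}} (F : T.Hom T') (b : π_ k T.Lim x) :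
    T'.toLimPi (F.lim x) k (piMap k F.lim rfl b) = F.limPi k (T.toLimPi x k b) :=
  Quotient.inductionOn b fun _ => rfl

theorem milnorMap_mk_mul (h h' : ∀ n, T.PiGroup x (k + 1) n) :
    milnorMap (k + 1) T x (LimOne.mk (T.piTower x (k + 1)) (h * h')) =
      milnorMap (k + 1) T x (LimOne.mk (T.piTower x (k + 1)) h) *
        milnorMap (k + 1) T x (LimOne.mk (T.piTower x (k + 1)) h') := by
  obtain ⟨b, H⟩ := exists_realizesPi h
  obtain ⟨b', H'⟩ := exists_realizesPi h'
  rw [milnorMap_mk H, milnorMap_mk H']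
  refine Eq.trans ?_ (HomotopyGroup.mul_spec (i := (0 : Fin (k + 1))) (p := b) (q := b')).symm
  exact milnorMap_mk (RealizesPi.mul (fun n => loopMul (T.X n) (x.1 n) k)
    (fun n => loopMul_const _ _ _) (fun n a a' => loopMap_loopMul _ _ _ _)
    (fun n a a' => pushClass_loopMul _ _ _)
    (fun n => (loopMap_loopMul (T.proj n) rfl b b').symm) H H')

theorem isShortExactGroup (k : ℕ) (T : FibrationTower.{u}) (x : T.Lim) :
    letI : CommGroup (T.LimOnePi x (k + 1)) := LimOne.commGroup fun _ => pi_mul_comm k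
    IsShortExactGroup (milnorMap (k + 1) T x) (T.toLimPi x (k + 1)) := by
  let _ : CommGroup (T.LimOnePi x (k + 1)) := LimOne.commGroup fun _ => pi_mul_comm k
  refine ⟨fun a a' => ?_, fun b b' => ?_, milnorMap_injective, toLimPi_eq_base_iff,
    toLimPi_surjective⟩
  · obtain ⟨h, rfl⟩ := limOne_mk_surjective a
    obtain ⟨h', rfl⟩ := limOne_mk_surjective a'
    exact milnorMap_mk_mul h h'
  · exact Subtype.ext (funext fun n => (piHom k (T.proj n) rfl).map_mul b b')

end FibrationTower

/-! ### Multiplications on homotopy groups induced by multiplications on spaces -/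

section PointwiseMul

variable {X : Type*} [TopologicalSpace X] {x : X}

/-- Pointwise multiplication of based cubes. -/
def cubeMul {N : Type*} (m : C(X × X, X)) (h : m (x, x) = x) :
    C(GenLoop N X x × GenLoop N X x, GenLoop N X x) :=
  ⟨fun z => ⟨m.comp (z.1.1.prodMk z.2.1), fun u hu => by
      change m (z.1 u, z.2 u) = x
      rw [GenLoop.boundary _ u hu, GenLoop.boundary _ u hu, h]⟩,
    continuous_genLoop_mk _ <| by
      change Continuous fun y : (GenLoop N X x × GenLoop N X x) × (N → I) =>
        m (y.1.1 y.2, y.1.2 y.2)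
      fun_prop⟩

theorem cubeMul_apply {N : Type*} (m : C(X × X, X)) (h : m (x, x) = x)
    (a b : GenLoop N X x) (u : N → I) : cubeMul m h (a, b) u = m (a u, b u) := rfl

/-- The operation on homotopy groups induced by pointwise multiplication. -/
def piPointwiseMul {k : ℕ} (m : C(X × X, X)) (h : m (x, x) = x) :
    π_ k X x → π_ k X x → π_ k X x :=
  Quotient.map₂ (fun a b => cubeMul m h (a, b)) fun a a' ha b b' hb => by
    obtain ⟨α⟩ := genLoop_homotopic_iff_joined.1 ha
    obtain ⟨β⟩ := genLoop_homotopic_iff_joined.1 hb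
    exact genLoop_homotopic_iff_joined.2 ⟨(α.prod β).map (cubeMul m h).continuous⟩

variable {k : ℕ}

theorem piPointwiseMul_distrib (m : C(X × X, X)) (h : m (x, x) = x) (a b c d : π_ (k + 1) X x) :
    piPointwiseMul m h (a * b) (c * d) = piPointwiseMul m h a c * piPointwiseMul m h b d := by
  have key : ∀ a b c d : GenLoop (Fin (k + 1)) X x,
      cubeMul m h (GenLoop.transAt 0 b a, GenLoop.transAt 0 d c) =
        GenLoop.transAt 0 (cubeMul m h (b, d)) (cubeMul m h (a, c)) := by
    intro a b c d
    ext u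
    rw [cubeMul_apply]
    simp only [GenLoop.transAt, GenLoop.coe_copy]
    split_ifs <;> rfl
  refine Quotient.inductionOn₂ a b fun a b => Quotient.inductionOn₂ c d fun c d => ?_
  refine (congrArg₂ (piPointwiseMul m h) (HomotopyGroup.mul_spec (i := (0 : Fin (k + 1))))
    (HomotopyGroup.mul_spec (i := (0 : Fin (k + 1))))).trans ?_
  refine Eq.trans ?_ (HomotopyGroup.mul_spec (i := (0 : Fin (k + 1)))).symm
  exact congrArg (Quotient.mk _) (key a b c d)

/-- The multiplication of an H-space whose unit is the basepoint induces an operation on homotopy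
groups which has the class of the constant cube as its unit. -/
theorem piPointwiseMul_isUnital (H : HSpace X) (he : H.e = x) (h : H.hmul (x, x) = x) :
    EckmannHilton.IsUnital (piPointwiseMul (k := k + 1) H.hmul h) 1 := by
  subst he
  refine { left_id := fun a => ?_, right_id := fun a => ?_ }
  · refine Quotient.inductionOn a fun a => Quotient.sound ?_
    exact ⟨⟨⟨H.eHmul.toContinuousMap.comp ⟨fun z => (z.1, a z.2), by fun_prop⟩,
      fun u => H.eHmul.apply_zero (a u), fun u => H.eHmul.apply_one (a u)⟩,
      fun t u hu => H.eHmul.eq_fst t (GenLoop.boundary a u hu)⟩⟩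
  · refine Quotient.inductionOn a fun a => Quotient.sound ?_
    exact ⟨⟨⟨H.hmulE.toContinuousMap.comp ⟨fun z => (z.1, a z.2), by fun_prop⟩,
      fun u => H.hmulE.apply_zero (a u), fun u => H.hmulE.apply_one (a u)⟩,
      fun t u hu => H.hmulE.eq_fst t (GenLoop.boundary a u hu)⟩⟩

theorem pi_isUnital : EckmannHilton.IsUnital (fun a b : π_ (k + 1) X x => a * b) 1 :=
  { left_id := one_mul, right_id := mul_one }

theorem piPointwiseMul_eq_mul (H : HSpace X) (he : H.e = x) (h : H.hmul (x, x) = x)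
    (a b : π_ (k + 1) X x) : piPointwiseMul H.hmul h a b = a * b :=
  congrFun (congrFun (EckmannHilton.mul (piPointwiseMul_isUnital H he h) pi_isUnital
    (piPointwiseMul_distrib H.hmul h)) a) b

theorem pi_mul_comm_of_hSpace (H : HSpace X) (he : H.e = x) (a b : π_ (k + 1) X x) :
    a * b = b * a := by
  have h : H.hmul (x, x) = x := by
    subst he
    exact H.hmul_e_e
  exact (EckmannHilton.mul_comm (piPointwiseMul_isUnital H he h) pi_isUnital
    (piPointwiseMul_distrib H.hmul h)).comm a b

theorem pushClass_cubeMul (H : HSpace X) (he : H.e = x) (h : H.hmul (x, x) = x)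
    (h' : cubeMul (N := Fin k) H.hmul h (GenLoop.const, GenLoop.const) = GenLoop.const)
    (a b : π_ (k + 1) X x) :
    pushClass (cubeMul H.hmul h) h' h' (Path.Homotopic.prod (loopClass a) (loopClass b)) =
      loopClass (a * b) := by
  rw [← piPointwiseMul_eq_mul H he h]
  exact Quotient.inductionOn₂ a b fun f g => rfl

end PointwiseMul

/-! ### Group laws -/

namespace IsGroupLaw

variable {A C : Type*} {m : A → A → A} {e : A} {m' : C → C → C} {e' : C}

theorem of_surjective (hm : IsGroupLaw m e) (P : A → C) (hP : ∀ a b, P (m a b) = m' (P a) (P b))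
    (he : P e = e') (hs : Function.Surjective P) : IsGroupLaw m' e' where
  assoc a b c := by
    obtain ⟨a, rfl⟩ := hs a
    obtain ⟨b, rfl⟩ := hs b
    obtain ⟨c, rfl⟩ := hs c
    rw [← hP, ← hP, ← hP, ← hP, hm.assoc]
  one_mul a := by
    obtain ⟨a, rfl⟩ := hs a
    rw [← he, ← hP, hm.one_mul]
  mul_one a := by
    obtain ⟨a, rfl⟩ := hs a
    rw [← he, ← hP, hm.mul_one]
  inv a := by
    obtain ⟨a, rfl⟩ := hs a
    obtain ⟨b, hb, hb'⟩ := hm.inv a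
    exact ⟨P b, by rw [← hP, hb, he], by rw [← hP, hb', he]⟩

/-- A monoid law is a group law if it maps onto a group with a kernel all of whose elements are
invertible. -/
theorem of_extension (assoc : ∀ a b c, m (m a b) c = m a (m b c)) (one_mul : ∀ a, m e a = a)
    (mul_one : ∀ a, m a e = a) (hm' : IsGroupLaw m' e') (P : A → C)
    (hP : ∀ a b, P (m a b) = m' (P a) (P b)) (hs : Function.Surjective P)
    (hk : ∀ a, P a = e' → ∃ b, m a b = e ∧ m b a = e) : IsGroupLaw m e where
  assoc := assoc
  one_mul := one_mul
  mul_one := mul_one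
  inv a := by
    obtain ⟨c, hc, hc'⟩ := hm'.inv (P a)
    obtain ⟨b, rfl⟩ := hs c
    obtain ⟨r, hr, -⟩ := hk (m a b) (by rw [hP, hc])
    obtain ⟨l, -, hl⟩ := hk (m b a) (by rw [hP, hc'])
    -- `m b r` is a right inverse of `a` and `m l b` is a left inverse
    have h : m l b = m b r := by
      rw [← mul_one (m l b), ← hr, assoc a b r, ← assoc (m l b), assoc l b a, hl, one_mul]
    exact ⟨m b r, by rw [← assoc, hr], by rw [← h, assoc, hl]⟩

theorem eq_of_inv (hm : IsGroupLaw m e) {a b c : A} (hb : m b a = e) (hc : m a c = e) : b = c := by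
  rw [← hm.mul_one b, ← hc, ← hm.assoc, hb, hm.one_mul]

end IsGroupLaw

/-! ### Path components of H-spaces -/

section PiZero

variable {X : Type u} [TopologicalSpace X] {x : X}

/-- The class of a point in `π_0`. -/
def piZeroMk (x : X) (a : X) : π_ 0 X x :=
  Quotient.mk _ ⟨ContinuousMap.const _ a, fun _ ⟨i, _⟩ => i.elim0⟩

theorem piZeroMk_surjective (x : X) : Function.Surjective (piZeroMk x) := by
  intro a
  refine Quotient.inductionOn a fun f => ⟨f 0, congrArg (Quotient.mk _) ?_⟩
  ext u
  exact congrArg f (Subsingleton.elim 0 u)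

theorem piZeroMk_eq {a b : X} (h : Joined a b) : piZeroMk x a = piZeroMk x b := by
  obtain ⟨γ⟩ := h
  exact Quotient.sound ⟨⟨⟨⟨fun z => γ z.1, by fun_prop⟩, fun _ => γ.source, fun _ => γ.target⟩,
    fun _ _ ⟨i, _⟩ => i.elim0⟩⟩

theorem piZeroMul_assoc (m : C(X × X, X)) (h : ∀ a b c, Joined (m (m (a, b), c)) (m (a, m (b, c))))
    (a b c : π_ 0 X x) :
    piZeroMul m (piZeroMul m a b) c = piZeroMul m a (piZeroMul m b c) := by
  obtain ⟨a, rfl⟩ := piZeroMk_surjective x a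
  obtain ⟨b, rfl⟩ := piZeroMk_surjective x b
  obtain ⟨c, rfl⟩ := piZeroMk_surjective x c
  exact piZeroMk_eq (h a b c)

theorem piZeroMul_base_left (m : C(X × X, X)) (h : ∀ a, Joined (m (x, a)) a) (a : π_ 0 X x) :
    piZeroMul m (FibrationTower.piBase x 0) a = a := by
  obtain ⟨a, rfl⟩ := piZeroMk_surjective x a
  exact piZeroMk_eq (h a)

theorem piZeroMul_base_right (m : C(X × X, X)) (h : ∀ a, Joined (m (a, x)) a) (a : π_ 0 X x) :
    piZeroMul m a (FibrationTower.piBase x 0) = a := by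
  obtain ⟨a, rfl⟩ := piZeroMk_surjective x a
  exact piZeroMk_eq (h a)

end PiZero

namespace FibrationTower.HStructure

variable {T : FibrationTower.{u}} {x : T.Lim} (S : T.HStructure x)

theorem hmul_base (n : ℕ) : (S.H n).hmul (x.1 n, x.1 n) = x.1 n := by
  rw [← S.unit n]
  exact (S.H n).hmul_e_e

/-- The path from `x a` to `a` given by the unit homotopy. -/
def unitLeftPath (n : ℕ) (a : T.X n) : Path ((S.H n).hmul (x.1 n, a)) a where
  toFun t := (S.H n).eHmul (t, a)
  continuous_toFun := by fun_prop
  source' := by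
    rw [(S.H n).eHmul.apply_zero, ← S.unit n]
    rfl
  target' := (S.H n).eHmul.apply_one a

/-- The path from `a x` to `a` given by the unit homotopy. -/
def unitRightPath (n : ℕ) (a : T.X n) : Path ((S.H n).hmul (a, x.1 n)) a where
  toFun t := (S.H n).hmulE (t, a)
  continuous_toFun := by fun_prop
  source' := by
    rw [(S.H n).hmulE.apply_zero, ← S.unit n]
    rfl
  target' := (S.H n).hmulE.apply_one a

theorem mul_comm_pi_one (S : T.HStructure x) (n : ℕ) (a b : π_ (0 + 1) (T.X n) (x.1 n)) :
    a * b = b * a :=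
  pi_mul_comm_of_hSpace (S.H n) (S.unit n) a b

theorem milnorMap_mul (a b : T.LimOnePi x 0) :
    letI : CommGroup (T.LimOnePi x 0) := LimOne.commGroup S.mul_comm_pi_one
    milnorMap 0 T x (a * b) = piZeroMul S.limMul (milnorMap 0 T x a) (milnorMap 0 T x b) := by
  obtain ⟨h, c, H, rfl, hc⟩ := exists_milnorMap_eq a
  obtain ⟨h', c', H', rfl, hc'⟩ := exists_milnorMap_eq b
  rw [hc, hc']
  refine milnorMap_mk (RealizesPi.mul (fun n => cubeMul (S.H n).hmul (S.hmul_base n))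
    (fun n => ?_) (fun n a a' => ?_)
    (fun n a a' => pushClass_cubeMul (S.H n) (S.unit n) _ _ a a') (fun n => rfl) H H')
  · ext u
    exact S.hmul_base n
  · apply GenLoop.ext
    intro u
    exact S.map_hmul n _ _

theorem toLimPi_mul (a b : π_ 0 T.Lim x) : T.toLimPi x 0 (piZeroMul S.limMul a b) =
    S.limPiZeroMul (T.toLimPi x 0 a) (T.toLimPi x 0 b) :=
  Quotient.inductionOn₂ a b fun _ _ => rfl

theorem isGroupLaw_limPiZeroMul_of_lim
    (h : IsGroupLaw (piZeroMul S.limMul) (FibrationTower.piBase x 0)) :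
    IsGroupLaw S.limPiZeroMul (T.limPiBase x 0) :=
  h.of_surjective (T.toLimPi x 0) S.toLimPi_mul rfl toLimPi_surjective

theorem piMap_piZeroMul (n : ℕ) (a b : π_ 0 (T.X (n + 1)) (x.1 (n + 1))) :
    piMap 0 (T.p n) (x.2 n) (piZeroMul (S.H (n + 1)).hmul a b) =
      piZeroMul (S.H n).hmul (piMap 0 (T.p n) (x.2 n) a) (piMap 0 (T.p n) (x.2 n) b) := by
  refine Quotient.inductionOn₂ a b fun a b => congrArg (Quotient.mk _) ?_
  ext u
  exact S.map_hmul n _ _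

/-- A limit of groups is a group; inverses are compatible because they are unique. -/
theorem isGroupLaw_limPiZeroMul
    (h : ∀ n, IsGroupLaw (piZeroMul (S.H n).hmul) (FibrationTower.piBase (x.1 n) 0)) :
    IsGroupLaw S.limPiZeroMul (T.limPiBase x 0) where
  assoc a b c := Subtype.ext (funext fun n => (h n).assoc _ _ _)
  one_mul a := Subtype.ext (funext fun n => (h n).one_mul _)
  mul_one a := Subtype.ext (funext fun n => (h n).mul_one _)
  inv a := by
    choose b hb hb' using fun n => (h n).inv (a.1 n)
    refine ⟨⟨b, fun n => ?_⟩, Subtype.ext (funext hb), Subtype.ext (funext hb')⟩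
    refine (h n).eq_of_inv (a := a.1 n) ?_ (hb n)
    rw [← a.2 n, ← S.piMap_piZeroMul, hb']
    exact (T.limPiBase x 0).2 n

namespace IsGroupLike

variable {S}

theorem isGroupLaw (hS : S.IsGroupLike) (n : ℕ) :
    IsGroupLaw (piZeroMul (S.H n).hmul) (FibrationTower.piBase (x.1 n) 0) where
  assoc := by
    obtain ⟨A, hA0, hA1, -⟩ := hS.assoc
    exact piZeroMul_assoc _ fun a b c =>
      ⟨⟨⟨fun t => A n (t, a, b, c), by fun_prop⟩, hA0 n a b c, hA1 n a b c⟩⟩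
  one_mul := piZeroMul_base_left _ fun a => ⟨S.unitLeftPath n a⟩
  mul_one := piZeroMul_base_right _ fun a => ⟨S.unitRightPath n a⟩
  inv a := by
    obtain ⟨a, rfl⟩ := piZeroMk_surjective _ a
    obtain ⟨b, hb, hb'⟩ := hS.inv n a
    exact ⟨piZeroMk _ b, piZeroMk_eq hb, piZeroMk_eq hb'⟩

/-- The coherent homotopies make `π_0` of the limit a monoid. It is an extension of the group
`lim π_0` by the group `lim¹ π_1`, and hence a group. -/
theorem isGroupLaw_lim (hS : S.IsGroupLike) :
    IsGroupLaw (piZeroMul S.limMul) (FibrationTower.piBase x 0) := by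
  refine IsGroupLaw.of_extension (piZeroMul_assoc _ ?_)
    (piZeroMul_base_left _ fun a => joined_of_paths (fun n => S.unitLeftPath n (a.1 n)) fun n t =>
      (hS.map_eHmul n t _).trans (by rw [a.2 n]; rfl))
    (piZeroMul_base_right _ fun a => joined_of_paths (fun n => S.unitRightPath n (a.1 n)) fun n t =>
      (hS.map_hmulE n t _).trans (by rw [a.2 n]; rfl))
    (S.isGroupLaw_limPiZeroMul hS.isGroupLaw) (T.toLimPi x 0) S.toLimPi_mul toLimPi_surjective ?_
  · obtain ⟨A, hA0, hA1, hA⟩ := hS.assoc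
    exact fun a b c => joined_of_paths
      (fun n => ⟨⟨fun t => A n (t, a.1 n, b.1 n, c.1 n), by fun_prop⟩, hA0 n _ _ _, hA1 n _ _ _⟩)
      fun n t => (hA n t _ _ _).trans (by rw [a.2 n, b.2 n, c.2 n]; rfl)
  · intro a ha
    obtain ⟨g, rfl⟩ := (toLimPi_eq_base_iff a).1 ha
    let _ : CommGroup (T.LimOnePi x 0) := LimOne.commGroup S.mul_comm_pi_one
    refine ⟨milnorMap 0 T x g⁻¹, ?_, ?_⟩
    · rw [← S.milnorMap_mul, mul_inv_cancel]
      exact milnorMap_limOneBase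
    · rw [← S.milnorMap_mul, inv_mul_cancel]
      exact milnorMap_limOneBase

end IsGroupLike

end FibrationTower.HStructure

end

theorem theorem2p1 :
    ∃ ι : ∀ (k : ℕ) (T : FibrationTower.{u}) (x : T.Lim), T.LimOnePi x k → π_ k T.Lim x,
      -- exactness, in every degree
      (∀ (k : ℕ) (T : FibrationTower.{u}) (x : T.Lim),
        IsShortExactPointed (T.limOneBase x k) (FibrationTower.piBase x k) (T.limPiBase x k)
          (ι k T x) (T.toLimPi x k)) ∧
      -- naturality of both maps
      (∀ (k : ℕ) (T T' : FibrationTower.{u}) (F : T.Hom T') (x : T.Lim),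
        (∀ a, ι k T' (F.lim x) (F.limOnePi k a) = piMap k F.lim rfl (ι k T x a)) ∧
        (∀ b, T'.toLimPi (F.lim x) k (piMap k F.lim rfl b) = F.limPi k (T.toLimPi x k b))) ∧
      -- groups, in degrees at least one
      (∀ (k : ℕ) (T : FibrationTower.{u}) (x : T.Lim),
        letI : CommGroup (T.LimOnePi x (k + 1)) := LimOne.commGroup fun _ => pi_mul_comm k
        IsShortExactGroup (ι (k + 1) T x) (T.toLimPi x (k + 1))) ∧
      -- abelian groups, in degrees at least two
      (∀ (k : ℕ) (T : FibrationTower.{u}) (x : T.Lim),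
        (letI : Group (π_ (k + 1 + 1) T.Lim x) := HomotopyGroup.group (Fin (k + 1 + 1))
          ∀ a b : π_ (k + 1 + 1) T.Lim x, a * b = b * a) ∧
        (∀ a b : T.LimPi x (k + 1 + 1), a * b = b * a)) ∧
      -- H-spaces, in degree zero
      (∀ (T : FibrationTower.{u}) (x : T.Lim) (S : T.HStructure x),
        (∃ hc : ∀ n, ∀ a b : π_ (0 + 1) (T.X n) (x.1 n), a * b = b * a,
          letI : CommGroup (T.LimOnePi x 0) := LimOne.commGroup hc
          ∀ a b : T.LimOnePi x 0, ι 0 T x (a * b) = piZeroMul S.limMul (ι 0 T x a) (ι 0 T x b)) ∧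
        (∀ a b : π_ 0 T.Lim x, T.toLimPi x 0 (piZeroMul S.limMul a b) =
          S.limPiZeroMul (T.toLimPi x 0 a) (T.toLimPi x 0 b)) ∧
        (IsGroupLaw (piZeroMul S.limMul) (FibrationTower.piBase x 0) →
          IsGroupLaw S.limPiZeroMul (T.limPiBase x 0)) ∧
        (S.IsGroupLike →
          (∀ n, IsGroupLaw (piZeroMul (S.H n).hmul) (FibrationTower.piBase (x.1 n) 0)) ∧
          IsGroupLaw (piZeroMul S.limMul) (FibrationTower.piBase x 0) ∧
          IsGroupLaw S.limPiZeroMul (T.limPiBase x 0))) := by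
  refine ⟨FibrationTower.milnorMap, FibrationTower.isShortExactPointed, fun k T T' F x =>
    ⟨FibrationTower.milnorMap_natural F, FibrationTower.toLimPi_natural F⟩,
    FibrationTower.isShortExactGroup, fun k T x =>
    ⟨pi_mul_comm k, fun a b => Subtype.ext (funext fun n => pi_mul_comm k (a.1 n) (b.1 n))⟩,
    fun T x S => ⟨⟨S.mul_comm_pi_one, S.milnorMap_mul⟩, S.toLimPi_mul,
      S.isGroupLaw_limPiZeroMul_of_lim, fun hS => ⟨hS.isGroupLaw, hS.isGroupLaw_lim,
        S.isGroupLaw_limPiZeroMul hS.isGroupLaw⟩⟩⟩
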